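/- **Conventions.** All manifolds are smooth, finite-dimensional and without boundary. Let $\mathscr G\rightrightarrows M$ be a Lie groupoid with source $s$, target $t$, units ${\rm Id}_m$, and product $g.h$ defined when $s(g)=t(h)$. Write $r_g\colon s^{-1}(t(g))\to\mathscr G$, $h\mapsto h.g$, and let $E=\mathrm{Id}^*\ker Ts\to M$ be its Lie algebroid, with fibre $E_m=\ker T_{{\rm Id}_m}s$. The right-invariant Maurer–Cartan form is $\theta_{\rm R}(g)w=T_gr_{g^{-1}}(w)\in E_{t(g)}$ for $w\in\ker T_gs$. Let $\mathbb B$ be the group of bisections, i.e. smooth sections $\beta\colon M\to\mathscr G$ of $s$ such that $t_*\beta:=t\circ\beta$ is a diffeomorphism of $M$; put $L_\beta(g)=\beta(t(g)).g$, $C_\beta(g)=\beta(t(g)).g.\beta(s(g))^{-1}$ and ${\rm ev}_m(\beta)=\beta(m)$. A map from a manifold $O$ to $\mathbb B$ is called smooth if the associated map $O\times M\to\mathscr G$ is smooth. Let $\pi\colon\mathscr P\to\Sigma$ be a principaloid $\mathscr G$-bundle: a surjective submersion, where $\mathscr P$ carries a right $\mathscr G$-action $\varrho_g(p)=p\blacktriangleleft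 g$ (defined when $\mu(p)=t(g)$) with smooth moment map $\mu\colon\mathscr P\to M$, preserving the fibres of $\pi$, and where $\Sigma$ is covered by open sets $O_i$, $i\in I$, with $\mathscr G$-equivariant local trivialisations $\tau_i\colon\pi^{-1}(O_i)\cong O_i\times\mathscr G$ (here $\mathscr G$ is a right $\mathscr G$-module through $s$ and right translations). A *connection 1-form* on $\mathscr P$ is a smooth 1-form $\Theta$ with values in $V\mathscr P=\ker T\pi$, viewed as an endomorphism of $T\mathscr P$, with $\Theta|_{V\mathscr P}={\rm id}$, $T\mu\circ\Theta=T\mu$, and $T_p\varrho_g(\ker\Theta_p)=\ker\Theta_{p\blacktriangleleft g}$ whenever $\mu(p)=t(g)$. Its *local connection data* are the smooth forms ${\rm A}_i$ with ${\rm A}_i(\sigma,m)\in T_\sigma^*O_i\otimes E_m$ for $(\sigma,m)\in O_i\times M$ such that, for $(\sigma,g)\in O_i\times\mathscr G$, $$\bigl(\tau_i^{-1\,*}\Theta\bigr)(\sigma,g)={\rm id}_{T_g\mathscr G}+T_{{\rm Id}_{t(g)}}r_g\circ{\rm A}_i(\sigma,t(g)),\qquad \tau_i^{-1\,*}\Theta:=T\tau_i\circ\Theta\circ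 T\tau_i^{-1}.$$ An *automorphism* of $\mathscr P$ covering $f\in{\rm Diff}(\Sigma)$ is a diffeomorphism $\Phi$ of $\mathscr P$ with $\pi\circ\Phi=f\circ\pi$ that is equivariant for the right $\mathscr G$-action ($\mu\circ\Phi=\mu$ and $\Phi(p\blacktriangleleft g)=\Phi(p)\blacktriangleleft g$). Its *local data* are the smooth maps $\gamma_{(j,i)}\colon O^f_{(j,i)}:=O_i\cap f^{-1}(O_j)\to\mathbb B$ with $\Phi(\tau_i^{-1}(\sigma,g))=\tau_j^{-1}\bigl(f(\sigma),L_{\gamma_{(j,i)}(\sigma)}(g)\bigr)$ for $\sigma\in O^f_{(j,i)}$, $g\in\mathscr G$. It is a *gauge transformation* if $f={\rm id}_\Sigma$; then put $\gamma_i:=\gamma_{(i,i)}$. **Proposition.** Let $\Theta$ be a connection 1-form on $\mathscr P$ with local connection data $\{{\rm A}_i\}_{i\in I}$, and let $\Phi$ be an automorphism of $\mathscr P$ covering $f$ with local data $\{\gamma_{(j,i)}\}$. Then $\Theta^\Phi:=\Phi^{-1\,*}\Theta=T\Phi\circ\Theta\circ T\Phi^{-1}$ is a connection 1-form on $\mathscr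 P$, it has local connection data $\{{\rm A}^\Phi_i\}_{i\in I}$, and these satisfy, for all $i,j\in I$, $\sigma\in O^f_{(j,i)}$ and $m\in M$, $${\rm A}_j^\Phi\bigl(f(\sigma),t_*(\gamma_{(j,i)}(\sigma))(m)\bigr)\circ T_\sigma f=T_{{\rm Id}_m}C_{\gamma_{(j,i)}(\sigma)}\circ{\rm A}_i(\sigma,m)-\bigl({\rm ev}_m\circ\gamma_{(j,i)}\bigr)^*\theta_{\rm R}(\sigma).$$ In particular, if $\Phi$ is a gauge transformation, then for all $i\in I$, $\sigma\in O_i$ and $m\in M$, $${\rm A}_i^\Phi\bigl(\sigma,t_*(\gamma_i(\sigma))(m)\bigr)=T_{{\rm Id}_m}C_{\gamma_i(\sigma)}\circ{\rm A}_i(\sigma,m)-\bigl({\rm ev}_m\circ\gamma_i\bigr)^*\theta_{\rm R}(\sigma).$$ -/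

import Mathlib

open scoped Manifold ContDiff

/-!
All manifolds are smooth, finite-dimensional and without boundary: a manifold modelled on the
finite-dimensional real vector space `E` carries `ChartedSpace E _` and `IsManifold 𝓘(ℝ, E) ∞ _`.

A map that the mathematics defines only on a closed fibre product `X ×_M Y ⊆ X × Y` is
represented by a total function whose values off the fibre product are never used. Since one of
the two maps to `M` is a submersion, the fibre product is an embedded submanifold, and smoothness
on that submanifold is `ContMDiffOn` on the corresponding subset.
-/

noncomputable section

namespace Principaloid

section Groupoids

variable {EM EG : Type*} [NormedAddCommGroup EM] [NormedSpace ℝ EM]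
  [NormedAddCommGroup EG] [NormedSpace ℝ EG]

/-- A Lie groupoid `𝒢 ⇉ M`. The product `mul g h = g.h` is meaningful when `s g = t h`. -/
structure LieGroupoid (EM EG : Type*) [NormedAddCommGroup EM] [NormedSpace ℝ EM]
    [NormedAddCommGroup EG] [NormedSpace ℝ EG]
    (M 𝒢 : Type*) [TopologicalSpace M] [ChartedSpace EM M]
    [TopologicalSpace 𝒢] [ChartedSpace EG 𝒢] where
  /-- source -/
  s : 𝒢 → M
  /-- target -/
  t : 𝒢 → M
  /-- the unit `Id_m` -/
  one : M → 𝒢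
  /-- inverse -/
  inv : 𝒢 → 𝒢
  /-- multiplication of composable arrows -/
  mul : 𝒢 → 𝒢 → 𝒢
  s_one : ∀ m, s (one m) = m
  t_one : ∀ m, t (one m) = m
  s_mul : ∀ g h, s g = t h → s (mul g h) = s h
  t_mul : ∀ g h, s g = t h → t (mul g h) = t g
  mul_assoc : ∀ g h k, s g = t h → s h = t k → mul (mul g h) k = mul g (mul h k)
  one_mul : ∀ g, mul (one (t g)) g = g
  mul_one : ∀ g, mul g (one (s g)) = g
  s_inv : ∀ g, s (inv g) = t g
  t_inv : ∀ g, t (inv g) = s g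
  mul_inv : ∀ g, mul g (inv g) = one (t g)
  inv_mul : ∀ g, mul (inv g) g = one (s g)
  isSubmersion_s : Manifold.IsSubmersion 𝓘(ℝ, EG) 𝓘(ℝ, EM) ∞ s
  isSubmersion_t : Manifold.IsSubmersion 𝓘(ℝ, EG) 𝓘(ℝ, EM) ∞ t
  contMDiff_s : ContMDiff 𝓘(ℝ, EG) 𝓘(ℝ, EM) ∞ s
  contMDiff_t : ContMDiff 𝓘(ℝ, EG) 𝓘(ℝ, EM) ∞ t
  contMDiff_one : ContMDiff 𝓘(ℝ, EM) 𝓘(ℝ, EG) ∞ one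
  contMDiff_inv : ContMDiff 𝓘(ℝ, EG) 𝓘(ℝ, EG) ∞ inv
  contMDiffOn_mul : ContMDiffOn (𝓘(ℝ, EG).prod 𝓘(ℝ, EG)) 𝓘(ℝ, EG) ∞
    (fun p : 𝒢 × 𝒢 => mul p.1 p.2) {p | s p.1 = t p.2}

variable {M 𝒢 : Type*} [TopologicalSpace M] [ChartedSpace EM M]
  [TopologicalSpace 𝒢] [ChartedSpace EG 𝒢]

namespace LieGroupoid

variable (G : LieGroupoid EM EG M 𝒢)

/-- The fibre `E_m = ker T_{Id_m} s` of the Lie algebroid `E = Id^* ker T s` of the groupoid. -/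
def algebroidFibre (m : M) : Submodule ℝ (TangentSpace 𝓘(ℝ, EG) (G.one m)) :=
  LinearMap.ker
    (mfderiv 𝓘(ℝ, EG) 𝓘(ℝ, EM) G.s (G.one m) :
      TangentSpace 𝓘(ℝ, EG) (G.one m) →ₗ[ℝ] TangentSpace 𝓘(ℝ, EM) (G.s (G.one m)))

/-- The tangent map `T_h r_g` of the right translation `r_g : s⁻¹{t g} → 𝒢`, `h ↦ h.g`.
It is meaningful on `ker T_h s`, the tangent space of the `s`-fibre, and is only used there:
on these vectors all derivatives of `r_g` within the `s`-fibre agree. -/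
def tangentRight (g h : 𝒢) :
    TangentSpace 𝓘(ℝ, EG) h →L[ℝ] TangentSpace 𝓘(ℝ, EG) (G.mul h g) :=
  mfderivWithin 𝓘(ℝ, EG) 𝓘(ℝ, EG) (fun k => G.mul k g) {k | G.s k = G.t g} h

/-- The tangent map `T_{Id_{t g}} r_g`, with values in `T_g 𝒢` as `Id_{t g}.g = g`. -/
def tangentRightUnit (g : 𝒢) :
    TangentSpace 𝓘(ℝ, EG) (G.one (G.t g)) →L[ℝ] TangentSpace 𝓘(ℝ, EG) g :=
  G.tangentRight g (G.one (G.t g))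

/-- The right-invariant Maurer-Cartan form `θ_R(g) w = T_g r_{g⁻¹} w`, for `w ∈ ker T_g s`,
with values in the tangent space at `g.g⁻¹ = Id_{t g}`. -/
def maurerCartan (g : 𝒢) :
    TangentSpace 𝓘(ℝ, EG) g →L[ℝ] TangentSpace 𝓘(ℝ, EG) (G.one (G.t g)) :=
  G.tangentRight (G.inv g) g

/-- A (global) bisection: a smooth section of `s` whose composite with `t` is a diffeomorphism. -/
structure Bisection where
  /-- the underlying section -/
  toFun : M → 𝒢
  contMDiff_toFun : ContMDiff 𝓘(ℝ, EM) 𝓘(ℝ, EG) ∞ toFun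
  s_toFun : ∀ m, G.s (toFun m) = m
  exists_diffeomorph : ∃ d : Diffeomorph 𝓘(ℝ, EM) 𝓘(ℝ, EM) M M ∞, ∀ m, d m = G.t (toFun m)

namespace Bisection

variable {G}

/-- The shadow action `t_*β : M → M`, `m ↦ t (β m)`. -/
def shadow (β : G.Bisection) (m : M) : M := G.t (β.toFun m)

/-- Left multiplication `L_β g = β(t g).g`. -/
def left (β : G.Bisection) (g : 𝒢) : 𝒢 := G.mul (β.toFun (G.t g)) g

/-- Conjugation `C_β g = β(t g).g.β(s g)⁻¹`. -/
def conj (β : G.Bisection) (g : 𝒢) : 𝒢 :=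
  G.mul (G.mul (β.toFun (G.t g)) g) (G.inv (β.toFun (G.s g)))

/-- The tangent map `T_{Id_m} C_β`, with values in the tangent space at
`C_β Id_m = Id_{t_*β m}`. -/
def tangentConj (β : G.Bisection) (m : M) :
    TangentSpace 𝓘(ℝ, EG) (G.one m) →L[ℝ] TangentSpace 𝓘(ℝ, EG) (G.one (β.shadow m)) :=
  mfderiv 𝓘(ℝ, EG) 𝓘(ℝ, EG) β.conj (G.one m)

/-- The pullback `(ev_m ∘ γ)^* θ_R` at `σ`, for a family `γ` of bisections parametrised by a
manifold. -/
def pullbackMaurerCartan {ES : Type*} [NormedAddCommGroup ES] [NormedSpace ℝ ES]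
    {S : Type*} [TopologicalSpace S] [ChartedSpace ES S]
    (γ : S → G.Bisection) (m : M) (σ : S) :
    TangentSpace 𝓘(ℝ, ES) σ →L[ℝ] TangentSpace 𝓘(ℝ, EG) (G.one ((γ σ).shadow m)) :=
  (G.maurerCartan ((γ σ).toFun m)).comp
    (mfderiv 𝓘(ℝ, ES) 𝓘(ℝ, EG) (fun σ' => (γ σ').toFun m) σ)

end Bisection

/-- A right `𝒢`-module structure on a manifold `X`. The action `act x g = x ◂ g` is meaningful
when `μ x = t g`. -/
structure RightModule (EX : Type*) [NormedAddCommGroup EX] [NormedSpace ℝ EX]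
    (X : Type*) [TopologicalSpace X] [ChartedSpace EX X] where
  /-- moment map -/
  μ : X → M
  /-- right action -/
  act : X → 𝒢 → X
  contMDiff_μ : ContMDiff 𝓘(ℝ, EX) 𝓘(ℝ, EM) ∞ μ
  contMDiffOn_act : ContMDiffOn (𝓘(ℝ, EX).prod 𝓘(ℝ, EG)) 𝓘(ℝ, EX) ∞
    (fun p : X × 𝒢 => act p.1 p.2) {p | μ p.1 = G.t p.2}
  μ_act : ∀ x g, μ x = G.t g → μ (act x g) = G.s g
  act_one : ∀ x, act x (G.one (μ x)) = x
  act_act : ∀ x g h, μ x = G.t g → G.s g = G.t h → act (act x g) h = act x (G.mul g h)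

end LieGroupoid

end Groupoids

section Bundles

variable {EM EG ES EP : Type*} [NormedAddCommGroup EM] [NormedSpace ℝ EM]
  [NormedAddCommGroup EG] [NormedSpace ℝ EG] [NormedAddCommGroup ES] [NormedSpace ℝ ES]
  [NormedAddCommGroup EP] [NormedSpace ℝ EP]
  {M 𝒢 : Type*} [TopologicalSpace M] [ChartedSpace EM M]
  [TopologicalSpace 𝒢] [ChartedSpace EG 𝒢]
  {S P : Type*} [TopologicalSpace S] [ChartedSpace ES S]
  [TopologicalSpace P] [ChartedSpace EP P]

variable (ES) in
/-- `τ` is a local trivialisation `π⁻¹(U) ≅ U × 𝒢` over the open set `U` of the base: a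
diffeomorphism over `U`, equivariant for the right `𝒢`-action on `P` and the right translations
on `𝒢` (whose moment map is `s`). -/
structure IsLocalTrivialisation {G : LieGroupoid EM EG M 𝒢} (mod : G.RightModule EP P)
    (π : P → S) (U : Set S) (τ : OpenPartialHomeomorph P (S × 𝒢)) : Prop where
  isOpen : IsOpen U
  source_eq : τ.source = π ⁻¹' U
  target_eq : τ.target = U ×ˢ Set.univ
  contMDiffOn : ContMDiffOn 𝓘(ℝ, EP) (𝓘(ℝ, ES).prod 𝓘(ℝ, EG)) ∞ τ τ.source
  contMDiffOn_symm : ContMDiffOn (𝓘(ℝ, ES).prod 𝓘(ℝ, EG)) 𝓘(ℝ, EP) ∞ τ.symm τ.target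
  fst_eq : ∀ p ∈ τ.source, (τ p).1 = π p
  μ_symm : ∀ σ ∈ U, ∀ g, mod.μ (τ.symm (σ, g)) = G.s g
  act_symm : ∀ σ ∈ U, ∀ g h, G.s g = G.t h →
    mod.act (τ.symm (σ, g)) h = τ.symm (σ, G.mul g h)

variable (ES EP S P) in
/-- A principaloid `𝒢`-bundle `P → S`: a fibre bundle in right `𝒢`-modules, with an action along
the fibres and with the right `𝒢`-module `𝒢` as typical fibre. -/
structure PrincipaloidBundle (G : LieGroupoid EM EG M 𝒢) extends G.RightModule EP P where
  /-- base projection -/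
  π : P → S
  contMDiff_π : ContMDiff 𝓘(ℝ, EP) 𝓘(ℝ, ES) ∞ π
  isSubmersion_π : Manifold.IsSubmersion 𝓘(ℝ, EP) 𝓘(ℝ, ES) ∞ π
  surjective_π : Function.Surjective π
  π_act : ∀ p g, μ p = G.t g → π (act p g) = π p
  locallyTrivial : ∀ σ : S, ∃ U : Set S, ∃ τ : OpenPartialHomeomorph P (S × 𝒢),
    σ ∈ U ∧ IsLocalTrivialisation ES toRightModule π U τ

namespace PrincipaloidBundle

variable {G : LieGroupoid EM EG M 𝒢} (B : PrincipaloidBundle ES EP S P G)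

/-- A trivialising cover `{O i}` of the base with `𝒢`-equivariant local trivialisations `τ i`. -/
structure TrivialisingCover (ι : Type*) where
  /-- the members of the cover -/
  O : ι → Set S
  /-- the local trivialisations -/
  τ : ι → OpenPartialHomeomorph P (S × 𝒢)
  cover : ∀ σ, ∃ i, σ ∈ O i
  isLocalTrivialisation : ∀ i, IsLocalTrivialisation ES B.toRightModule B.π (O i) (τ i)

/-- The tangent map `T_p ϱ_g` of `ϱ_g : μ⁻¹{t g} → P`, `p ↦ p ◂ g`. It is meaningful on
`ker T_p μ`, the tangent space of the `μ`-fibre, and is only used there: on these vectors all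
derivatives of `ϱ_g` within the `μ`-fibre agree. -/
def tangentAct (g : 𝒢) (p : P) :
    TangentSpace 𝓘(ℝ, EP) p →L[ℝ] TangentSpace 𝓘(ℝ, EP) (B.act p g) :=
  mfderivWithin 𝓘(ℝ, EP) 𝓘(ℝ, EP) (fun q => B.act q g) {q | B.μ q = G.t g} p

/-- A (compatible) connection 1-form on `P`: a smooth 1-form `Θ` with values in the vertical
bundle `V P = ker T π`, viewed as a smooth bundle endomorphism of `T P`, which restricts to the
identity on `V P`, satisfies `T μ ∘ Θ = T μ`, and has a `𝒢`-invariant kernel. -/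
structure IsConnection
    (Θ : ∀ p : P, TangentSpace 𝓘(ℝ, EP) p →L[ℝ] TangentSpace 𝓘(ℝ, EP) p)
    [IsManifold 𝓘(ℝ, EP) ∞ P] : Prop where
  contMDiff : ContMDiff 𝓘(ℝ, EP).tangent 𝓘(ℝ, EP).tangent ∞
    (fun v : TangentBundle 𝓘(ℝ, EP) P => (⟨v.1, Θ v.1 v.2⟩ : TangentBundle 𝓘(ℝ, EP) P))
  vertical : ∀ p v, mfderiv 𝓘(ℝ, EP) 𝓘(ℝ, ES) B.π p (Θ p v) = 0
  apply_vertical : ∀ p v, mfderiv 𝓘(ℝ, EP) 𝓘(ℝ, ES) B.π p v = 0 → Θ p v = v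
  tangent_μ : ∀ p v,
    mfderiv 𝓘(ℝ, EP) 𝓘(ℝ, EM) B.μ p (Θ p v) = mfderiv 𝓘(ℝ, EP) 𝓘(ℝ, EM) B.μ p v
  invariant : ∀ g p, B.μ p = G.t g →
    B.tangentAct g p '' {v | Θ p v = 0} = {w | Θ (B.act p g) w = 0}

/-- `Φ` is a principaloid-bundle automorphism of `P` covering the diffeomorphism `f` of the base;
it is a gauge transformation when `f` is the identity. -/
structure IsAutomorphism (Φ : Diffeomorph 𝓘(ℝ, EP) 𝓘(ℝ, EP) P P ∞)
    (f : Diffeomorph 𝓘(ℝ, ES) 𝓘(ℝ, ES) S S ∞) : Prop where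
  π_apply : ∀ p, B.π (Φ p) = f (B.π p)
  μ_apply : ∀ p, B.μ (Φ p) = B.μ p
  apply_act : ∀ p g, B.μ p = G.t g → Φ (B.act p g) = B.act (Φ p) g

/-- The transformed 1-form `Θ^Φ = T Φ ∘ Θ ∘ T Φ⁻¹`. -/
def gaugeTransform (Φ : Diffeomorph 𝓘(ℝ, EP) 𝓘(ℝ, EP) P P ∞)
    (Θ : ∀ p : P, TangentSpace 𝓘(ℝ, EP) p →L[ℝ] TangentSpace 𝓘(ℝ, EP) p) (q : P) :
    TangentSpace 𝓘(ℝ, EP) q →L[ℝ] TangentSpace 𝓘(ℝ, EP) q :=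
  let a : TangentSpace 𝓘(ℝ, EP) q →L[ℝ] TangentSpace 𝓘(ℝ, EP) (Φ.symm q) :=
    mfderiv 𝓘(ℝ, EP) 𝓘(ℝ, EP) Φ.symm q
  let b : TangentSpace 𝓘(ℝ, EP) (Φ.symm q) →L[ℝ] TangentSpace 𝓘(ℝ, EP) q :=
    mfderiv 𝓘(ℝ, EP) 𝓘(ℝ, EP) Φ (Φ.symm q)
  b.comp ((Θ (Φ.symm q)).comp a)

variable {B}

namespace TrivialisingCover

variable {ι : Type*} (T : B.TrivialisingCover ι)

/-- The local form `((τ i)^{-1*} Θ)(σ, g) = T (τ i) ∘ Θ ∘ T (τ i)⁻¹`, for `σ ∈ O i`, as an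
endomorphism of `T_{(σ, g)} (S × 𝒢) = T_σ S × T_g 𝒢`. -/
def localForm (Θ : ∀ p : P, TangentSpace 𝓘(ℝ, EP) p →L[ℝ] TangentSpace 𝓘(ℝ, EP) p)
    (i : ι) (σ : S) (g : 𝒢) :
    TangentSpace 𝓘(ℝ, ES) σ × TangentSpace 𝓘(ℝ, EG) g →L[ℝ]
      TangentSpace 𝓘(ℝ, ES) σ × TangentSpace 𝓘(ℝ, EG) g :=
  let p : P := (T.τ i).symm (σ, g)
  let a : TangentSpace 𝓘(ℝ, ES) σ × TangentSpace 𝓘(ℝ, EG) g →L[ℝ] TangentSpace 𝓘(ℝ, EP) p :=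
    mfderiv (𝓘(ℝ, ES).prod 𝓘(ℝ, EG)) 𝓘(ℝ, EP) (T.τ i).symm (σ, g)
  let b : TangentSpace 𝓘(ℝ, EP) p →L[ℝ] TangentSpace 𝓘(ℝ, ES) σ × TangentSpace 𝓘(ℝ, EG) g :=
    mfderiv 𝓘(ℝ, EP) (𝓘(ℝ, ES).prod 𝓘(ℝ, EG)) (T.τ i) p
  b.comp ((Θ p).comp a)

/-- `A` is the family of local connection data of `Θ`: for each `i`, a smooth form `A i` with
`A i σ m ∈ T_σ^* O_i ⊗ E_m` for `σ ∈ O i` and `m ∈ M`, such that, for `σ ∈ O i` and `g ∈ 𝒢`,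
`((τ i)^{-1*} Θ)(σ, g) = id_{T_g 𝒢} + T_{Id_{t g}} r_g ∘ A i (σ, t g)`. -/
structure IsLocalConnectionData [IsManifold 𝓘(ℝ, ES) ∞ S] [IsManifold 𝓘(ℝ, EG) ∞ 𝒢]
    (Θ : ∀ p : P, TangentSpace 𝓘(ℝ, EP) p →L[ℝ] TangentSpace 𝓘(ℝ, EP) p)
    (A : ι → ∀ (σ : S) (m : M), TangentSpace 𝓘(ℝ, ES) σ →L[ℝ] G.algebroidFibre m) : Prop where
  contMDiffOn : ∀ i, ContMDiffOn (𝓘(ℝ, ES).tangent.prod 𝓘(ℝ, EM)) 𝓘(ℝ, EG).tangent ∞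
    (fun x : TangentBundle 𝓘(ℝ, ES) S × M =>
      (⟨G.one x.2, (A i x.1.1 x.2 x.1.2 : TangentSpace 𝓘(ℝ, EG) (G.one x.2))⟩ :
        TangentBundle 𝓘(ℝ, EG) 𝒢))
    {x | x.1.1 ∈ T.O i}
  formula : ∀ i, ∀ σ ∈ T.O i, ∀ (g : 𝒢) (v : TangentSpace 𝓘(ℝ, ES) σ)
    (V : TangentSpace 𝓘(ℝ, EG) g),
    T.localForm Θ i σ g (v, V) = (0, V + G.tangentRightUnit g (A i σ (G.t g) v))

/-- `γ` is a family of local data of the automorphism `Φ` covering `f`: smooth maps `γ j i` from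
`O i ∩ f⁻¹(O j)` to the bisections, such that `Φ` is given there in the trivialisations by
`(σ, g) ↦ (f σ, L_{γ j i σ} g)`. Smoothness of a family of bisections is smoothness of the map
`(σ, m) ↦ γ j i σ m`. -/
structure IsLocalPresentation (Φ : Diffeomorph 𝓘(ℝ, EP) 𝓘(ℝ, EP) P P ∞)
    (f : Diffeomorph 𝓘(ℝ, ES) 𝓘(ℝ, ES) S S ∞) (γ : ι → ι → S → G.Bisection) : Prop where
  contMDiffOn : ∀ j i, ContMDiffOn (𝓘(ℝ, ES).prod 𝓘(ℝ, EM)) 𝓘(ℝ, EG) ∞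
    (fun x : S × M => (γ j i x.1).toFun x.2) {x | x.1 ∈ T.O i ∧ f x.1 ∈ T.O j}
  apply_symm : ∀ j i, ∀ σ ∈ T.O i, f σ ∈ T.O j → ∀ g,
    Φ ((T.τ i).symm (σ, g)) = (T.τ j).symm (f σ, (γ j i σ).left g)

end TrivialisingCover

end PrincipaloidBundle

end Bundles

end Principaloid

end

/-! In trivialisations `Φ` is the map `F(σ, g) = (f σ, L_β(g))` with `β = γ j i σ`, and `TF`
intertwines the local form of `Θ` with that of `Θ^Φ` (`locForm_gaugeTransform`). Evaluate this at
`(σ, Id_m)` on `(v, 0)` and put `b = β(m)`. Since `L_β(Id_m) = b`, one side is `T(ev_m ∘ γ) v + T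
r_b (A'(f σ, t b)(Tf v))` and the other is `TL_β (A_i(σ, m) v)`. Applying `T r_{b⁻¹}` turns the
first summand into the Maurer-Cartan term, cancels `T r_b` in the second, and turns `TL_β` into
`TC_β`, because `C_β` is `r_{b⁻¹} ∘ L_β` on `s⁻¹(m)`. This is the law, for any data `A'` of `Θ^Φ`.

That `Θ^Φ` is a connection is transport along `TΦ`. Invariance of its kernel needs `TΦ` to commute
with `Tϱ_g` on `ker Tμ`, which contains `ker Θ`. Every connection has local data
(`exists_isLocalConnectionData`): its local form at units determines it at all arrows, by invariance
of the kernel (`locForm_apply`).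

The recurring difficulty is that `r_g` and `ϱ_g` live only on fibres of `s` and `μ`, where
derivatives within the fibre are not unique. Vectors tangent to a fibre are therefore written as
images under the derivative of a local retraction onto it (`exists_isFibreRetraction`); on such
vectors the chain rule leaves no ambiguity. -/

open scoped Topology

noncomputable section

namespace Principaloid

/-! ### Chain rules for derivatives between model vector spaces -/

section TangentMaps

variable {E H X E' H' Y E'' H'' Z : Type*}
  [NormedAddCommGroup E] [NormedSpace ℝ E] [TopologicalSpace H]
  [NormedAddCommGroup E'] [NormedSpace ℝ E'] [TopologicalSpace H']
  [NormedAddCommGroup E''] [NormedSpace ℝ E''] [TopologicalSpace H'']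
  {I : ModelWithCorners ℝ E H} {J : ModelWithCorners ℝ E' H'} {K : ModelWithCorners ℝ E'' H''}
  [TopologicalSpace X] [ChartedSpace H X] [TopologicalSpace Y] [ChartedSpace H' Y]
  [TopologicalSpace Z] [ChartedSpace H'' Z]

variable (I J) in
/-- The derivative `mfderiv` as a map between the model vector spaces. -/
def tder (f : X → Y) (x : X) : E →L[ℝ] E' := mfderiv I J f x

variable (I J) in
/-- The derivative `mfderivWithin` as a map between the model vector spaces. -/
def tderWithin (f : X → Y) (s : Set X) (x : X) : E →L[ℝ] E' := mfderivWithin I J f s x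

/-- The point `y` is kept apart from `f x` so that the rule applies where the two agree only by an
identity such as `Id.g = g`. -/
lemma tder_comp {g : Y → Z} {f : X → Y} {x : X} {y : Y} (hg : MDifferentiableAt J K g y)
    (hf : MDifferentiableAt I J f x) (h : f x = y) (v : E) :
    tder J K g y (tder I J f x v) = tder I K (fun z => g (f z)) x v := by
  subst h
  exact (mfderiv_comp_apply x hg hf v).symm

/-- No unique differentiability of `s` is needed: whichever derivative of `g` within `s` is chosen,
composing it with that of `f` gives a derivative on a full neighbourhood of `x`, and that one is
unique. -/
lemma tderWithin_comp {g : Y → Z} {f : X → Y} {x : X} {y : Y} {s : Set Y}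
    (hg : MDifferentiableWithinAt J K g s y)
    (hf : MDifferentiableAt I J f x) (h : f x = y) (hs : ∀ᶠ z in 𝓝 x, f z ∈ s) (v : E) :
    tderWithin J K g s y (tder I J f x v) = tder I K (fun z => g (f z)) x v := by
  subst h
  have h1 := HasMFDerivWithinAt.comp x hg.hasMFDerivWithinAt
    (hf.hasMFDerivAt.hasMFDerivWithinAt (s := f ⁻¹' s)) subset_rfl
  exact (congrArg (fun D => D v) (h1.hasMFDerivAt hs).mfderiv).symm

lemma mdifferentiableAt_comp_within {g : Y → Z} {f : X → Y} {x : X} {s : Set Y}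
    (hg : MDifferentiableWithinAt J K g s (f x))
    (hf : MDifferentiableAt I J f x) (hs : ∀ᶠ z in 𝓝 x, f z ∈ s) :
    MDifferentiableAt I K (fun z => g (f z)) x := by
  rw [← mdifferentiableWithinAt_univ] at hf ⊢
  exact MDifferentiableWithinAt.comp_of_preimage_mem_nhdsWithin x hg hf
    (by rw [nhdsWithin_univ]; exact hs)

lemma tder_congr {f g : X → Y} {x : X} (h : f =ᶠ[𝓝 x] g) : tder I J f x = tder I J g x :=
  h.mfderiv_eq

lemma tder_congr_apply {f g : X → Y} {x : X} (h : ∀ᶠ z in 𝓝 x, f z = g z) (v : E) :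
    tder I J f x v = tder I J g x v :=
  by rw [tder_congr h]

lemma tder_id (x : X) (v : E) : tder I I (fun y : X => y) x v = v := by
  have : mfderiv I I (fun y : X => y) x = ContinuousLinearMap.id ℝ _ := mfderiv_id
  exact congrArg (fun D => D v) this

lemma tder_const (x : X) (y : Y) (v : E) : tder I J (fun _ : X => y) x v = 0 := by
  have : mfderiv I J (fun _ : X => y) x = 0 := mfderiv_const
  exact congrArg (fun D => D v) this

lemma tder_prodMk {f : X → Y} {g : X → Z} {x : X} (hf : MDifferentiableAt I J f x)
    (hg : MDifferentiableAt I K g x) (v : E) :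
    tder I (J.prod K) (fun z => (f z, g z)) x v = (tder I J f x v, tder I K g x v) :=
  congrArg (fun D => D v) (mfderiv_prodMk hf hg)

lemma tder_prodMk_left (x : X) (y : Y) (v : E) :
    tder I (I.prod J) (fun z : X => (z, y)) x v = (v, 0) :=
  congrArg (fun D => D v) (mfderiv_prod_left (I := I) (I' := J) (x₀ := x) (y₀ := y))

lemma tder_prodMk_right (x : X) (y : Y) (v : E') :
    tder J (I.prod J) (fun z : Y => (x, z)) y v = (0, v) :=
  congrArg (fun D => D v) (mfderiv_prod_right (I := I) (I' := J) (x₀ := x) (y₀ := y))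

lemma tder_fst (x : X × Y) (v : E × E') : tder (I.prod J) I (Prod.fst : X × Y → X) x v = v.1 :=
  congrArg (fun D => D v) (mfderiv_fst (I := I) (I' := J) (x := x))

lemma tder_snd (x : X × Y) (v : E × E') : tder (I.prod J) J (Prod.snd : X × Y → Y) x v = v.2 :=
  congrArg (fun D => D v) (mfderiv_snd (I := I) (I' := J) (x := x))

lemma tder_fst_comp {f : X → Y × Z} {x : X} (hf : MDifferentiableAt I (J.prod K) f x) (v : E) :
    tder I J (fun z => (f z).1) x v = (tder I (J.prod K) f x v).1 := by
  rw [← tder_comp (g := Prod.fst) mdifferentiableAt_fst hf rfl, tder_fst]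

lemma tder_snd_comp {f : X → Y × Z} {x : X} (hf : MDifferentiableAt I (J.prod K) f x) (v : E) :
    tder I K (fun z => (f z).2) x v = (tder I (J.prod K) f x v).2 := by
  rw [← tder_comp (g := Prod.snd) mdifferentiableAt_snd hf rfl, tder_snd]

lemma tangentBundle_mk_congr {x y : X} (h : x = y) (v : E) :
    (⟨x, v⟩ : TangentBundle I X) = ⟨y, v⟩ := by
  subst h
  rfl

end TangentMaps

/-! ### Local retractions onto the fibres of a submersion -/

section Retractions

variable {E E' X Y : Type*} [NormedAddCommGroup E] [NormedSpace ℝ E]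
  [NormedAddCommGroup E'] [NormedSpace ℝ E']
  [TopologicalSpace X] [ChartedSpace E X] [TopologicalSpace Y] [ChartedSpace E' Y]

/-- `ρ` is, to first order at `x`, a retraction of a neighbourhood of `x` to the fibre of `f`
through `x`. -/
structure IsFibreRetraction (f : X → Y) (x : X) (ρ : X → X) : Prop where
  mdifferentiableAt : MDifferentiableAt 𝓘(ℝ, E) 𝓘(ℝ, E) ρ x
  apply_self : ρ x = x
  eventually_eq : ∀ᶠ y in 𝓝 x, f (ρ y) = f x
  tder_eq : ∀ v, tder 𝓘(ℝ, E) 𝓘(ℝ, E') f x v = 0 → tder 𝓘(ℝ, E) 𝓘(ℝ, E) ρ x v = v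

/-- In submersion charts `f` is the projection `(a, b) ↦ a`; freezing `a` at its value at `x` gives
the retraction, whose derivative fixes the vectors `(0, b)`. -/
lemma exists_isFibreRetraction [IsManifold 𝓘(ℝ, E) ∞ X] [IsManifold 𝓘(ℝ, E') ∞ Y]
    {f : X → Y} {x : X} (h : Manifold.IsSubmersionAt 𝓘(ℝ, E) 𝓘(ℝ, E') ∞ f x) :
    ∃ ρ : X → X, IsFibreRetraction (E := E) (E' := E') f x ρ := by
  set φ := h.domChart
  set ψ := h.codChart
  set e := h.equiv
  have hx : x ∈ φ.source := h.mem_domChart_source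
  have hfx : f x ∈ ψ.source := h.mem_codChart_source
  have hw : ∀ z ∈ φ.target, ψ (f (φ.symm z)) = (e z).1 := by
    intro z hz
    have := h.writtenInCharts (show z ∈ (h.domChart.extend 𝓘(ℝ, E)).target by simpa [φ] using hz)
    simpa using this
  have hφd : ∀ y ∈ φ.source, MDifferentiableAt 𝓘(ℝ, E) 𝓘(ℝ, E) φ y := fun y hy =>
    (contMDiffAt_of_mem_maximalAtlas h.domChart_mem_maximalAtlas hy).mdifferentiableAt (by simp)
  have hφsd : ∀ y ∈ φ.target, MDifferentiableAt 𝓘(ℝ, E) 𝓘(ℝ, E) φ.symm y := fun y hy =>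
    (contMDiffAt_symm_of_mem_maximalAtlas
      h.domChart_mem_maximalAtlas hy).mdifferentiableAt (by simp)
  have hψd : MDifferentiableAt 𝓘(ℝ, E') 𝓘(ℝ, E') ψ (f x) :=
    (contMDiffAt_of_mem_maximalAtlas h.codChart_mem_maximalAtlas hfx).mdifferentiableAt (by simp)
  have hfd : MDifferentiableAt 𝓘(ℝ, E) 𝓘(ℝ, E') f x := h.contMDiffAt.mdifferentiableAt (by simp)
  -- The affine map `z ↦ L z + c` keeps the second coordinate and replaces the first by that of `φ
  -- x`.
  set L : E →L[ℝ] E := e.symm.toContinuousLinearMap ∘L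
    ((ContinuousLinearMap.inr ℝ E' h.complement) ∘L
      ((ContinuousLinearMap.snd ℝ E' h.complement) ∘L e.toContinuousLinearMap))
  set c : E := e.symm ((e (φ x)).1, 0)
  have hLc : ∀ z, L z + c = e.symm ((e (φ x)).1, (e z).2) := by
    intro z
    apply e.injective
    simp [L, c]
  have hLcx : L (φ x) + c = φ x := by rw [hLc]; simp
  have hAd : ∀ z, MDifferentiableAt 𝓘(ℝ, E) 𝓘(ℝ, E) (fun z => L z + c) z := fun z =>
    (L.differentiableAt.add_const c).mdifferentiableAt
  have hAder : ∀ z v, tder 𝓘(ℝ, E) 𝓘(ℝ, E) (fun z => L z + c) z v = L v := by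
    intro z v
    have h1 : HasFDerivAt (fun z => L z + c) L z := L.hasFDerivAt.add_const c
    exact congrArg (fun D => D v) h1.hasMFDerivAt.mfderiv
  have hcd : MDifferentiableAt 𝓘(ℝ, E) 𝓘(ℝ, E) (fun y => L (φ y) + c) x :=
    MDifferentiableAt.comp (g := fun z => L z + c) x (hAd _) (hφd x hx)
  have hfs : ∀ᶠ y in 𝓝 x, y ∈ φ.source := φ.open_source.mem_nhds hx
  refine ⟨fun y => φ.symm (L (φ y) + c), ?_, ?_, ?_, ?_⟩
  · refine MDifferentiableAt.comp (g := φ.symm) (f := fun y => L (φ y) + c) x (hφsd _ ?_) hcd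
    rw [hLcx]; exact φ.map_source hx
  · simp only [hLcx]; exact φ.left_inv hx
  · have h1 : ∀ᶠ y in 𝓝 x, L (φ y) + c ∈ φ.target := by
      apply hcd.continuousAt.preimage_mem_nhds
      rw [hLcx]; exact φ.open_target.mem_nhds (φ.map_source hx)
    filter_upwards [h1] with y hy
    apply ψ.injOn (h.source_subset_preimage_source (φ.map_target hy)) hfx
    rw [hw _ hy, hLc]
    have := hw _ (φ.map_source hx)
    rw [φ.left_inv hx] at this
    rw [this]; simp
  · intro v hv
    -- A vector killed by `Tf` has zero first coordinate, so `L` fixes its coordinate expression.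
    have h1 : (e (tder 𝓘(ℝ, E) 𝓘(ℝ, E) φ x v)).1 = 0 := by
      have a1 := tder_comp (g := ψ) (f := f) (x := x) hψd hfd rfl v
      rw [hv, map_zero] at a1
      set Q : E →L[ℝ] E' := (ContinuousLinearMap.fst ℝ E' h.complement) ∘L e.toContinuousLinearMap
      have a2 : tder 𝓘(ℝ, E) 𝓘(ℝ, E') (fun z => ψ (f z)) x
          = tder 𝓘(ℝ, E) 𝓘(ℝ, E') (fun z => Q (φ z)) x := by
        apply tder_congr
        filter_upwards [hfs] with y hy
        have := hw _ (φ.map_source hy)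
        rw [φ.left_inv hy] at this
        exact this
      rw [a2, ← tder_comp (g := Q) (y := φ x) Q.differentiableAt.mdifferentiableAt (hφd x hx) rfl]
        at a1
      have a3 : tder 𝓘(ℝ, E) 𝓘(ℝ, E') Q (φ x) = Q :=
        Q.hasFDerivAt.hasMFDerivAt.mfderiv
      rw [a3] at a1
      exact a1.symm
    have hLv : L (tder 𝓘(ℝ, E) 𝓘(ℝ, E) φ x v) = tder 𝓘(ℝ, E) 𝓘(ℝ, E) φ x v := by
      apply e.injective
      apply Prod.ext
      · simp [L, h1]
      · simp [L]
    rw [← tder_comp (g := φ.symm) (f := fun y => L (φ y) + c) (y := φ x)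
      (hφsd _ (φ.map_source hx)) hcd hLcx,
      ← tder_comp (g := fun z => L z + c) (y := φ x) (hAd _) (hφd x hx) rfl, hAder, hLv,
      tder_comp (hφsd _ (φ.map_source hx)) (hφd x hx) rfl, ← tder_id (I := 𝓘(ℝ, E)) x v]
    rw [tder_id]
    have : tder 𝓘(ℝ, E) 𝓘(ℝ, E) (fun z => φ.symm (φ z)) x
        = tder 𝓘(ℝ, E) 𝓘(ℝ, E) (fun z => z) x := by
      apply tder_congr
      filter_upwards [hfs] with y hy using φ.left_inv hy
    rw [this, tder_id]

end Retractions

/-! ### Right translations and bisections of the groupoid -/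

namespace LieGroupoid

variable {EM EG : Type*} [NormedAddCommGroup EM] [NormedSpace ℝ EM]
  [NormedAddCommGroup EG] [NormedSpace ℝ EG]
  {M 𝒢 : Type*} [TopologicalSpace M] [ChartedSpace EM M]
  [TopologicalSpace 𝒢] [ChartedSpace EG 𝒢]
  (G : LieGroupoid EM EG M 𝒢)
  {E H X : Type*} [NormedAddCommGroup E] [NormedSpace ℝ E] [TopologicalSpace H]
  {I : ModelWithCorners ℝ E H} [TopologicalSpace X] [ChartedSpace H X]

lemma mdifferentiableAt_mul {c d : X → 𝒢} {x : X}
    (hc : MDifferentiableAt I 𝓘(ℝ, EG) c x) (hd : MDifferentiableAt I 𝓘(ℝ, EG) d x)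
    (h : ∀ᶠ z in 𝓝 x, G.s (c z) = G.t (d z)) :
    MDifferentiableAt I 𝓘(ℝ, EG) (fun z => G.mul (c z) (d z)) x :=
  mdifferentiableAt_comp_within (f := fun z => (c z, d z))
    ((G.contMDiffOn_mul (c x, d x) h.self_of_nhds).mdifferentiableWithinAt (by simp))
    (hc.prodMk hd) h

lemma mdifferentiableWithinAt_mul_right {g h : 𝒢} (hgh : G.s h = G.t g) :
    MDifferentiableWithinAt 𝓘(ℝ, EG) 𝓘(ℝ, EG) (fun k => G.mul k g) {k | G.s k = G.t g} h :=
  MDifferentiableWithinAt.comp (u := {p : 𝒢 × 𝒢 | G.s p.1 = G.t p.2}) h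
    ((G.contMDiffOn_mul (h, g) hgh).mdifferentiableWithinAt (by simp))
    (mdifferentiableWithinAt_id.prodMk mdifferentiableWithinAt_const) (fun _ hk => hk)

/-- `G.tangentRight` between the model vector spaces. -/
def tRight (g h : 𝒢) : EG →L[ℝ] EG :=
  tderWithin 𝓘(ℝ, EG) 𝓘(ℝ, EG) (fun k => G.mul k g) {k | G.s k = G.t g} h

lemma tRight_tder {c : X → 𝒢} {x : X} {g h : 𝒢} (hc : MDifferentiableAt I 𝓘(ℝ, EG) c x)
    (hx : c x = h) (hs : ∀ᶠ z in 𝓝 x, G.s (c z) = G.t g) (v : E) :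
    G.tRight g h (tder I 𝓘(ℝ, EG) c x v) = tder I 𝓘(ℝ, EG) (fun z => G.mul (c z) g) x v :=
  tderWithin_comp (G.mdifferentiableWithinAt_mul_right (hx ▸ hs.self_of_nhds)) hc hx hs v

section Retraction

variable [IsManifold 𝓘(ℝ, EM) ∞ M] [IsManifold 𝓘(ℝ, EG) ∞ 𝒢]

lemma exists_retraction (g : 𝒢) :
    ∃ ρ : 𝒢 → 𝒢, IsFibreRetraction (E := EG) (E' := EM) G.s g ρ :=
  exists_isFibreRetraction (G.isSubmersion_s.isSubmersionAt g)

/-- On `s⁻¹(m)` translation by `Id_m` is the identity. -/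
lemma tRight_one {m : M} {X : EG} (hX : tder 𝓘(ℝ, EG) 𝓘(ℝ, EM) G.s (G.one m) X = 0) :
    G.tRight (G.one m) (G.one m) X = X := by
  obtain ⟨ρ, hρ⟩ := G.exists_retraction (G.one m)
  have hs : ∀ᶠ z in 𝓝 (G.one m), G.s (ρ z) = m := by
    filter_upwards [hρ.eventually_eq] with z hz
    rw [hz, G.s_one]
  rw [← hρ.tder_eq X hX, G.tRight_tder hρ.mdifferentiableAt hρ.apply_self
    (by simpa only [G.t_one] using hs)]
  refine tder_congr_apply ?_ X
  filter_upwards [hs] with z hz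
  rw [← hz, G.mul_one]

/-- On `s⁻¹(t b)` the composite `r_{b⁻¹} ∘ r_b` is the identity. This later strips `T r_b` from the
connection data. -/
lemma tRight_inv_tRight {b : 𝒢} {X : EG}
    (hX : tder 𝓘(ℝ, EG) 𝓘(ℝ, EM) G.s (G.one (G.t b)) X = 0) :
    G.tRight (G.inv b) b (G.tRight b (G.one (G.t b)) X) = X := by
  obtain ⟨ρ, hρ⟩ := G.exists_retraction (G.one (G.t b))
  have hs : ∀ᶠ z in 𝓝 (G.one (G.t b)), G.s (ρ z) = G.t b := by
    filter_upwards [hρ.eventually_eq] with z hz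
    rw [hz, G.s_one]
  conv_lhs => rw [← hρ.tder_eq X hX]
  rw [G.tRight_tder hρ.mdifferentiableAt hρ.apply_self hs,
    G.tRight_tder (G.mdifferentiableAt_mul hρ.mdifferentiableAt mdifferentiableAt_const hs)
      (by rw [hρ.apply_self, G.one_mul]) (by
        filter_upwards [hs] with z hz
        rw [G.s_mul _ _ hz, G.t_inv])]
  conv_rhs => rw [← hρ.tder_eq X hX]
  refine tder_congr_apply ?_ X
  filter_upwards [hs] with z hz
  rw [G.mul_assoc _ _ _ hz (G.t_inv b).symm, G.mul_inv, ← hz, G.mul_one]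

end Retraction

namespace Bisection

variable {G} (β : G.Bisection)

lemma mdifferentiable_left : MDifferentiable 𝓘(ℝ, EG) 𝓘(ℝ, EG) β.left := fun _ =>
  G.mdifferentiableAt_mul
    ((β.contMDiff_toFun.comp G.contMDiff_t).mdifferentiable (by simp) _) mdifferentiableAt_id
    (.of_forall fun _ => β.s_toFun _)

lemma s_left (g : 𝒢) : G.s (β.left g) = G.s g := G.s_mul _ _ (β.s_toFun _)

lemma left_one (m : M) : β.left (G.one m) = β.toFun m := by
  unfold left
  rw [G.t_one]
  have := G.mul_one (β.toFun m)
  rwa [β.s_toFun] at this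

lemma mdifferentiable_conj : MDifferentiable 𝓘(ℝ, EG) 𝓘(ℝ, EG) β.conj := fun _ =>
  G.mdifferentiableAt_mul (d := fun g => G.inv (β.toFun (G.s g))) (β.mdifferentiable_left _)
    ((G.contMDiff_inv.comp (β.contMDiff_toFun.comp G.contMDiff_s)).mdifferentiable (by simp) _)
    (.of_forall fun g => by rw [G.t_inv, β.s_toFun]; exact β.s_left g)

variable [IsManifold 𝓘(ℝ, EM) ∞ M] [IsManifold 𝓘(ℝ, EG) ∞ 𝒢]

/-- For `s g = m` the last factor of `C_β(g)` is the constant `β(m)⁻¹`, so `C_β` and `r_{β(m)⁻¹} ∘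
L_β` agree along the fibre, though not around it. -/
lemma tRight_inv_tder_left {m : M} {X : EG}
    (hX : tder 𝓘(ℝ, EG) 𝓘(ℝ, EM) G.s (G.one m) X = 0) :
    G.tRight (G.inv (β.toFun m)) (β.toFun m) (tder 𝓘(ℝ, EG) 𝓘(ℝ, EG) β.left (G.one m) X) =
      tder 𝓘(ℝ, EG) 𝓘(ℝ, EG) β.conj (G.one m) X := by
  obtain ⟨ρ, hρ⟩ := G.exists_retraction (G.one m)
  have hs : ∀ᶠ z in 𝓝 (G.one m), G.s (ρ z) = m := by
    filter_upwards [hρ.eventually_eq] with z hz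
    rw [hz, G.s_one]
  have hL : MDifferentiableAt 𝓘(ℝ, EG) 𝓘(ℝ, EG) β.left (G.one m) :=
    β.mdifferentiable_left _
  have hC : MDifferentiableAt 𝓘(ℝ, EG) 𝓘(ℝ, EG) β.conj (G.one m) :=
    β.mdifferentiable_conj _
  conv_lhs => rw [← hρ.tder_eq X hX]
  conv_rhs => rw [← hρ.tder_eq X hX]
  rw [tder_comp hL hρ.mdifferentiableAt hρ.apply_self,
    tder_comp hC hρ.mdifferentiableAt hρ.apply_self,
    G.tRight_tder (c := fun z => β.left (ρ z)) (hL.comp_of_eq _ hρ.mdifferentiableAt hρ.apply_self)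
      (by rw [hρ.apply_self, β.left_one])
      (by filter_upwards [hs] with z hz; rw [β.s_left, hz, G.t_inv, β.s_toFun])]
  refine tder_congr_apply ?_ X
  filter_upwards [hs] with z hz
  rw [conj, hz, left]

end Bisection

end LieGroupoid

section Bundles

variable {EM EG ES EP : Type*} [NormedAddCommGroup EM] [NormedSpace ℝ EM]
  [NormedAddCommGroup EG] [NormedSpace ℝ EG] [NormedAddCommGroup ES] [NormedSpace ℝ ES]
  [NormedAddCommGroup EP] [NormedSpace ℝ EP]
  {M 𝒢 : Type*} [TopologicalSpace M] [ChartedSpace EM M]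
  [TopologicalSpace 𝒢] [ChartedSpace EG 𝒢]
  {S P : Type*} [TopologicalSpace S] [ChartedSpace ES S]
  [TopologicalSpace P] [ChartedSpace EP P]
  {G : LieGroupoid EM EG M 𝒢}

/-! ### Tangent maps of local trivialisations -/

namespace IsLocalTrivialisation

variable {mod : G.RightModule EP P} {π : P → S} {U : Set S}
  {τ : OpenPartialHomeomorph P (S × 𝒢)} (hτ : IsLocalTrivialisation ES mod π U τ)

include hτ

lemma mem_target {σ : S} (hσ : σ ∈ U) (g : 𝒢) : (σ, g) ∈ τ.target := by
  rw [hτ.target_eq]; exact ⟨hσ, trivial⟩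

lemma symm_mem_source {σ : S} (hσ : σ ∈ U) (g : 𝒢) : τ.symm (σ, g) ∈ τ.source :=
  τ.map_target (hτ.mem_target hσ g)

lemma right_inv {σ : S} (hσ : σ ∈ U) (g : 𝒢) : τ (τ.symm (σ, g)) = (σ, g) :=
  τ.right_inv (hτ.mem_target hσ g)

lemma fst_mem {p : P} (hp : p ∈ τ.source) : (τ p).1 ∈ U := by
  have := τ.map_source hp
  rw [hτ.target_eq] at this
  exact this.1

lemma μ_eq {p : P} (hp : p ∈ τ.source) : mod.μ p = G.s (τ p).2 := by
  have := hτ.μ_symm _ (hτ.fst_mem hp) (τ p).2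
  rwa [Prod.mk.eta, τ.left_inv hp] at this

lemma eventually_fst_mem {σ : S} (hσ : σ ∈ U) (g : 𝒢) : ∀ᶠ z : S × 𝒢 in 𝓝 (σ, g), z.1 ∈ U :=
  continuous_fst.continuousAt.preimage_mem_nhds (hτ.isOpen.mem_nhds hσ)

lemma mdifferentiableAt {p : P} (hp : p ∈ τ.source) :
    MDifferentiableAt 𝓘(ℝ, EP) (𝓘(ℝ, ES).prod 𝓘(ℝ, EG)) τ p :=
  (hτ.contMDiffOn.contMDiffAt (τ.open_source.mem_nhds hp)).mdifferentiableAt (by simp)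

lemma mdifferentiableAt_symm {σ : S} (hσ : σ ∈ U) (g : 𝒢) :
    MDifferentiableAt (𝓘(ℝ, ES).prod 𝓘(ℝ, EG)) 𝓘(ℝ, EP) τ.symm (σ, g) :=
  (hτ.contMDiffOn_symm.contMDiffAt
    (τ.open_target.mem_nhds (hτ.mem_target hσ g))).mdifferentiableAt (by simp)

lemma tder_tder_symm {σ : S} (hσ : σ ∈ U) {g : 𝒢} (v : ES × EG) :
    tder 𝓘(ℝ, EP) (𝓘(ℝ, ES).prod 𝓘(ℝ, EG)) τ (τ.symm (σ, g))
      (tder (𝓘(ℝ, ES).prod 𝓘(ℝ, EG)) 𝓘(ℝ, EP) τ.symm (σ, g) v) = v := by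
  rw [tder_comp (hτ.mdifferentiableAt (hτ.symm_mem_source hσ g)) (hτ.mdifferentiableAt_symm hσ g)
    rfl, tder_congr_apply (g := fun z => z), tder_id]
  filter_upwards [hτ.eventually_fst_mem hσ g] with z hz using hτ.right_inv hz z.2

lemma tder_symm_tder {p : P} (hp : p ∈ τ.source) {z : S × 𝒢} (hz : z = τ p) (v : EP) :
    tder (𝓘(ℝ, ES).prod 𝓘(ℝ, EG)) 𝓘(ℝ, EP) τ.symm z
      (tder 𝓘(ℝ, EP) (𝓘(ℝ, ES).prod 𝓘(ℝ, EG)) τ p v) = v := by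
  subst hz
  rw [tder_comp (y := τ p) (hτ.mdifferentiableAt_symm (hτ.fst_mem hp) _) (hτ.mdifferentiableAt hp)
    rfl, tder_congr_apply (g := fun z => z), tder_id]
  filter_upwards [τ.open_source.mem_nhds hp] with q hq using τ.left_inv hq

lemma tder_fst {p : P} (hp : p ∈ τ.source) (v : EP) :
    (tder 𝓘(ℝ, EP) (𝓘(ℝ, ES).prod 𝓘(ℝ, EG)) τ p v).1 = tder 𝓘(ℝ, EP) 𝓘(ℝ, ES) π p v := by
  rw [← tder_fst_comp (hτ.mdifferentiableAt hp)]
  refine tder_congr_apply ?_ v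
  filter_upwards [τ.open_source.mem_nhds hp] with q hq using hτ.fst_eq q hq

/-- Locally `μ = s ∘ pr₂ ∘ τ`. -/
lemma tder_s_snd {p : P} (hp : p ∈ τ.source) {g : 𝒢} (hg : (τ p).2 = g) (v : EP) :
    tder 𝓘(ℝ, EG) 𝓘(ℝ, EM) G.s g (tder 𝓘(ℝ, EP) (𝓘(ℝ, ES).prod 𝓘(ℝ, EG)) τ p v).2 =
      tder 𝓘(ℝ, EP) 𝓘(ℝ, EM) mod.μ p v := by
  rw [← tder_snd_comp (hτ.mdifferentiableAt hp),
    tder_comp (f := fun z => (τ z).2) (G.contMDiff_s.mdifferentiable (by simp) _)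
      (mdifferentiableAt_snd.comp p (hτ.mdifferentiableAt hp)) hg]
  refine tder_congr_apply ?_ v
  filter_upwards [τ.open_source.mem_nhds hp] with q hq using (hτ.μ_eq hq).symm

/-- As `μ` is locally `s ∘ pr₂ ∘ τ`, a retraction for `s` on the factor `𝒢` pulls back to `P`; `μ`
need not be assumed a submersion. -/
lemma exists_retraction [IsManifold 𝓘(ℝ, EM) ∞ M] [IsManifold 𝓘(ℝ, EG) ∞ 𝒢]
    {p : P} (hp : p ∈ τ.source) :
    ∃ ρ : P → P, IsFibreRetraction (E := EP) (E' := EM) mod.μ p ρ := by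
  obtain ⟨ρ, hρ⟩ := G.exists_retraction (τ p).2
  have hsrc : ∀ᶠ q in 𝓝 p, q ∈ τ.source := τ.open_source.mem_nhds hp
  have h1 : MDifferentiableAt 𝓘(ℝ, EP) 𝓘(ℝ, ES) (fun q => (τ q).1) p :=
    mdifferentiableAt_fst.comp p (hτ.mdifferentiableAt hp)
  have h2 : MDifferentiableAt 𝓘(ℝ, EP) 𝓘(ℝ, EG) (fun q => (τ q).2) p :=
    mdifferentiableAt_snd.comp p (hτ.mdifferentiableAt hp)
  have h3 : MDifferentiableAt 𝓘(ℝ, EP) 𝓘(ℝ, EG) (fun q => ρ (τ q).2) p :=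
    hρ.mdifferentiableAt.comp p h2
  have h4 : (fun q => ((τ q).1, ρ (τ q).2)) p = τ p := by simp only [hρ.apply_self]
  have h5 : MDifferentiableAt (𝓘(ℝ, ES).prod 𝓘(ℝ, EG)) 𝓘(ℝ, EP) τ.symm (τ p) :=
    hτ.mdifferentiableAt_symm (hτ.fst_mem hp) _
  refine ⟨fun q => τ.symm ((τ q).1, ρ (τ q).2), ?_, ?_, ?_, ?_⟩
  · exact h5.comp_of_eq p (h1.prodMk h3) h4
  · simp only [hρ.apply_self, Prod.mk.eta, τ.left_inv hp]
  · filter_upwards [h2.continuousAt.eventually hρ.eventually_eq, hsrc] with q hq hqs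
    rw [hτ.μ_symm _ (hτ.fst_mem hqs), hq, hτ.μ_eq hp]
  · intro v hv
    rw [← hτ.tder_s_snd hp rfl] at hv
    rw [← tder_comp (g := τ.symm) h5 (h1.prodMk h3) h4, tder_prodMk h1 h3,
      ← tder_comp (g := ρ) hρ.mdifferentiableAt h2 rfl, tder_fst_comp (hτ.mdifferentiableAt hp),
      tder_snd_comp (hτ.mdifferentiableAt hp), hρ.tder_eq _ hv, Prod.mk.eta,
      hτ.tder_symm_tder hp rfl]

end IsLocalTrivialisation

/-! ### Derivative of the right action along moment-map fibres -/

namespace LieGroupoid.RightModule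

variable (mod : G.RightModule EP P)
  {E H X : Type*} [NormedAddCommGroup E] [NormedSpace ℝ E] [TopologicalSpace H]
  {I : ModelWithCorners ℝ E H} [TopologicalSpace X] [ChartedSpace H X]

lemma mdifferentiableWithinAt_act {g : 𝒢} {p : P} (hp : mod.μ p = G.t g) :
    MDifferentiableWithinAt 𝓘(ℝ, EP) 𝓘(ℝ, EP) (fun q => mod.act q g) {q | mod.μ q = G.t g} p :=
  MDifferentiableWithinAt.comp (u := {p : P × 𝒢 | mod.μ p.1 = G.t p.2}) p
    ((mod.contMDiffOn_act (p, g) hp).mdifferentiableWithinAt (by simp))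
    (mdifferentiableWithinAt_id.prodMk mdifferentiableWithinAt_const) (fun _ hk => hk)

/-- The derivative of `p ↦ p ◂ g` within the fibre of the moment map, between the model vector
spaces. -/
def tAct (g : 𝒢) (p : P) : EP →L[ℝ] EP :=
  tderWithin 𝓘(ℝ, EP) 𝓘(ℝ, EP) (fun q => mod.act q g) {q | mod.μ q = G.t g} p

lemma tAct_tder {c : X → P} {x : X} {g : 𝒢} {p : P} (hc : MDifferentiableAt I 𝓘(ℝ, EP) c x)
    (hx : c x = p) (hs : ∀ᶠ z in 𝓝 x, mod.μ (c z) = G.t g) (v : E) :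
    mod.tAct g p (tder I 𝓘(ℝ, EP) c x v) = tder I 𝓘(ℝ, EP) (fun z => mod.act (c z) g) x v :=
  tderWithin_comp (mod.mdifferentiableWithinAt_act (hx ▸ hs.self_of_nhds)) hc hx hs v

lemma mdifferentiableAt_act {c : X → P} {x : X} {g : 𝒢} (hc : MDifferentiableAt I 𝓘(ℝ, EP) c x)
    (hs : ∀ᶠ z in 𝓝 x, mod.μ (c z) = G.t g) :
    MDifferentiableAt I 𝓘(ℝ, EP) (fun z => mod.act (c z) g) x :=
  mdifferentiableAt_comp_within (mod.mdifferentiableWithinAt_act hs.self_of_nhds) hc hs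

end LieGroupoid.RightModule

/-! ### Tangent maps of diffeomorphisms are invertible -/

section Diffeomorphisms

variable (Φ : Diffeomorph 𝓘(ℝ, EP) 𝓘(ℝ, EP) P P ∞)

lemma mdifferentiableAt_diffeomorph (p : P) : MDifferentiableAt 𝓘(ℝ, EP) 𝓘(ℝ, EP) Φ p :=
  Φ.contMDiff.mdifferentiable (by simp) p

lemma tder_symm_tder {p q : P} (h : q = Φ p) (v : EP) :
    tder 𝓘(ℝ, EP) 𝓘(ℝ, EP) Φ.symm q (tder 𝓘(ℝ, EP) 𝓘(ℝ, EP) Φ p v) = v := by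
  rw [tder_comp (mdifferentiableAt_diffeomorph Φ.symm _) (mdifferentiableAt_diffeomorph Φ _) h.symm]
  simp only [Diffeomorph.symm_apply_apply, tder_id]

lemma tder_tder_symm {p q : P} (h : q = Φ p) (v : EP) :
    tder 𝓘(ℝ, EP) 𝓘(ℝ, EP) Φ p (tder 𝓘(ℝ, EP) 𝓘(ℝ, EP) Φ.symm q v) = v := by
  subst h
  rw [tder_comp (mdifferentiableAt_diffeomorph Φ _) (mdifferentiableAt_diffeomorph Φ.symm _)
    (by simp)]
  simp only [Diffeomorph.apply_symm_apply, tder_id]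

end Diffeomorphisms

/-! ### The transformed form is a connection -/

namespace PrincipaloidBundle

variable {B : PrincipaloidBundle ES EP S P G}

/-- Every tangent vector at `Φ p` is some `TΦ v`, so this inverse-free form suffices to check each
connection axiom. -/
lemma gaugeTransform_tder (Φ : Diffeomorph 𝓘(ℝ, EP) 𝓘(ℝ, EP) P P ∞)
    (Θ : ∀ p : P, TangentSpace 𝓘(ℝ, EP) p →L[ℝ] TangentSpace 𝓘(ℝ, EP) p)
    {p q : P} (h : q = Φ p) (v : EP) :
    gaugeTransform Φ Θ q (tder 𝓘(ℝ, EP) 𝓘(ℝ, EP) Φ p v) =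
      tder 𝓘(ℝ, EP) 𝓘(ℝ, EP) Φ p (Θ p v) := by
  have hp : p = Φ.symm q := by rw [h, Φ.symm_apply_apply]
  subst hp
  have h1 := tder_symm_tder Φ h v
  exact congrArg
    (fun w : EP => tder 𝓘(ℝ, EP) 𝓘(ℝ, EP) Φ (Φ.symm q) (Θ (Φ.symm q) w)) h1

namespace IsAutomorphism

variable {Φ : Diffeomorph 𝓘(ℝ, EP) 𝓘(ℝ, EP) P P ∞} {f : Diffeomorph 𝓘(ℝ, ES) 𝓘(ℝ, ES) S S ∞}
  (hΦ : B.IsAutomorphism Φ f)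

include hΦ

lemma tder_μ {p q : P} (h : q = Φ p) (v : EP) :
    tder 𝓘(ℝ, EP) 𝓘(ℝ, EM) B.μ q (tder 𝓘(ℝ, EP) 𝓘(ℝ, EP) Φ p v) =
      tder 𝓘(ℝ, EP) 𝓘(ℝ, EM) B.μ p v := by
  rw [tder_comp (B.contMDiff_μ.mdifferentiable (by simp) _) (mdifferentiableAt_diffeomorph Φ _)
    h.symm]
  simp only [hΦ.μ_apply]

lemma tder_π {p q : P} (h : q = Φ p) (v : EP) :
    tder 𝓘(ℝ, EP) 𝓘(ℝ, ES) B.π q (tder 𝓘(ℝ, EP) 𝓘(ℝ, EP) Φ p v) =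
      tder 𝓘(ℝ, ES) 𝓘(ℝ, ES) f (B.π p) (tder 𝓘(ℝ, EP) 𝓘(ℝ, ES) B.π p v) := by
  rw [tder_comp (B.contMDiff_π.mdifferentiable (by simp) _) (mdifferentiableAt_diffeomorph Φ _)
    h.symm, tder_comp (mdifferentiableAt_diffeomorph f _)
    (B.contMDiff_π.mdifferentiable (by simp) _) rfl]
  simp only [hΦ.π_apply]

/-- Equivariance of `Φ` is available only on the fibre `μ⁻¹(t g)`; a retraction onto it allows the
identity to be differentiated in the direction `v`. -/
lemma tAct_tder [IsManifold 𝓘(ℝ, EM) ∞ M] [IsManifold 𝓘(ℝ, EG) ∞ 𝒢] {g : 𝒢} {p : P}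
    (hp : B.μ p = G.t g) {v : EP} (hv : tder 𝓘(ℝ, EP) 𝓘(ℝ, EM) B.μ p v = 0) :
    B.tAct g (Φ p) (tder 𝓘(ℝ, EP) 𝓘(ℝ, EP) Φ p v) =
      tder 𝓘(ℝ, EP) 𝓘(ℝ, EP) Φ (B.act p g) (B.tAct g p v) := by
  obtain ⟨U, τ, hU, hτ⟩ := B.locallyTrivial (B.π p)
  obtain ⟨ρ, hρ⟩ := hτ.exists_retraction (p := p) (by rw [hτ.source_eq]; exact hU)
  have hs : ∀ᶠ z in 𝓝 p, B.μ (ρ z) = G.t g := by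
    filter_upwards [hρ.eventually_eq] with z hz
    rw [hz, hp]
  rw [← hρ.tder_eq v hv, tder_comp (mdifferentiableAt_diffeomorph Φ _) hρ.mdifferentiableAt
    hρ.apply_self, B.toRightModule.tAct_tder hρ.mdifferentiableAt hρ.apply_self hs,
    B.toRightModule.tAct_tder (c := fun z => Φ (ρ z))
      ((mdifferentiableAt_diffeomorph Φ _).comp p hρ.mdifferentiableAt)
      (by rw [hρ.apply_self]) (by simpa only [hΦ.μ_apply] using hs),
    tder_comp (mdifferentiableAt_diffeomorph Φ _)
      (B.toRightModule.mdifferentiableAt_act hρ.mdifferentiableAt hs) (by rw [hρ.apply_self])]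
  refine tder_congr_apply ?_ v
  filter_upwards [hs] with z hz using (hΦ.apply_act _ _ hz).symm

end IsAutomorphism

namespace IsConnection

variable [IsManifold 𝓘(ℝ, EP) ∞ P]
  {Θ : ∀ p : P, TangentSpace 𝓘(ℝ, EP) p →L[ℝ] TangentSpace 𝓘(ℝ, EP) p}

/-- Since `Tμ = Tμ ∘ Θ`, horizontal vectors are tangent to the fibres of `μ`, where `Tϱ_g` is
meaningful. -/
lemma tder_μ_eq_zero (hΘ : B.IsConnection Θ) {p : P} {v : EP} (h : Θ p v = (0 : EP)) :
    tder 𝓘(ℝ, EP) 𝓘(ℝ, EM) B.μ p v = 0 := by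
  have h1 : tder 𝓘(ℝ, EP) 𝓘(ℝ, EM) B.μ p (Θ p v) = tder 𝓘(ℝ, EP) 𝓘(ℝ, EM) B.μ p v :=
    hΘ.tangent_μ p v
  have h2 : tder 𝓘(ℝ, EP) 𝓘(ℝ, EM) B.μ p (Θ p v) = 0 :=
    (congrArg (tder 𝓘(ℝ, EP) 𝓘(ℝ, EM) B.μ p) h).trans (map_zero _)
  rw [← h1, h2]

lemma gaugeTransform [IsManifold 𝓘(ℝ, EM) ∞ M] [IsManifold 𝓘(ℝ, EG) ∞ 𝒢]
    (hΘ : B.IsConnection Θ) {Φ : Diffeomorph 𝓘(ℝ, EP) 𝓘(ℝ, EP) P P ∞}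
    {f : Diffeomorph 𝓘(ℝ, ES) 𝓘(ℝ, ES) S S ∞} (hΦ : B.IsAutomorphism Φ f) :
    B.IsConnection (gaugeTransform Φ Θ) where
  contMDiff := by
    have h1 : ContMDiff 𝓘(ℝ, EP).tangent 𝓘(ℝ, EP).tangent ∞ (tangentMap 𝓘(ℝ, EP) 𝓘(ℝ, EP) Φ) :=
      Φ.contMDiff.contMDiff_tangentMap (by simp)
    have h2 : ContMDiff 𝓘(ℝ, EP).tangent 𝓘(ℝ, EP).tangent ∞
        (tangentMap 𝓘(ℝ, EP) 𝓘(ℝ, EP) Φ.symm) :=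
      Φ.symm.contMDiff.contMDiff_tangentMap (by simp)
    refine (h1.comp (hΘ.contMDiff.comp h2)).congr fun v => ?_
    -- The composite of tangent maps has base point `Φ(Φ⁻¹ v.1)` instead of `v.1`.
    exact tangentBundle_mk_congr (Φ.apply_symm_apply v.1).symm _
  vertical p v := by
    obtain ⟨p, rfl⟩ : ∃ q, Φ q = p := Φ.surjective p
    obtain ⟨v, rfl⟩ : ∃ w, tder 𝓘(ℝ, EP) 𝓘(ℝ, EP) Φ p w = v := ⟨_, tder_tder_symm Φ rfl v⟩
    have h1 : tder 𝓘(ℝ, EP) 𝓘(ℝ, ES) B.π p (Θ p v) = 0 := hΘ.vertical p v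
    change tder 𝓘(ℝ, EP) 𝓘(ℝ, ES) B.π (Φ p) _ = 0
    erw [gaugeTransform_tder Φ Θ rfl, hΦ.tder_π rfl, h1, map_zero]
  apply_vertical p v hv := by
    obtain ⟨p, rfl⟩ : ∃ q, Φ q = p := Φ.surjective p
    obtain ⟨v, rfl⟩ : ∃ w, tder 𝓘(ℝ, EP) 𝓘(ℝ, EP) Φ p w = v := ⟨_, tder_tder_symm Φ rfl v⟩
    change tder 𝓘(ℝ, EP) 𝓘(ℝ, ES) B.π (Φ p) _ = 0 at hv
    rw [hΦ.tder_π rfl] at hv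
    -- `Tf` is injective, so vertical vectors for `Φ p` come only from vertical vectors at `p`.
    have h1 : tder 𝓘(ℝ, EP) 𝓘(ℝ, ES) B.π p v = 0 := by
      rw [← tder_symm_tder f rfl (tder 𝓘(ℝ, EP) 𝓘(ℝ, ES) B.π p v), hv, map_zero]
    have h2 : Θ p v = v := hΘ.apply_vertical p v h1
    exact (gaugeTransform_tder Φ Θ rfl v).trans
      (congrArg (tder 𝓘(ℝ, EP) 𝓘(ℝ, EP) Φ p) h2)
  tangent_μ p v := by
    obtain ⟨p, rfl⟩ : ∃ q, Φ q = p := Φ.surjective p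
    obtain ⟨v, rfl⟩ : ∃ w, tder 𝓘(ℝ, EP) 𝓘(ℝ, EP) Φ p w = v := ⟨_, tder_tder_symm Φ rfl v⟩
    have h1 : tder 𝓘(ℝ, EP) 𝓘(ℝ, EM) B.μ p (Θ p v) = tder 𝓘(ℝ, EP) 𝓘(ℝ, EM) B.μ p v :=
      hΘ.tangent_μ p v
    change tder 𝓘(ℝ, EP) 𝓘(ℝ, EM) B.μ (Φ p) _ = tder 𝓘(ℝ, EP) 𝓘(ℝ, EM) B.μ (Φ p) _
    erw [gaugeTransform_tder Φ Θ rfl, hΦ.tder_μ rfl, hΦ.tder_μ rfl, h1]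
  invariant g p hp := by
    obtain ⟨p, rfl⟩ : ∃ q, Φ q = p := Φ.surjective p
    rw [hΦ.μ_apply] at hp
    have hact : B.act (Φ p) g = Φ (B.act p g) := (hΦ.apply_act p g hp).symm
    have hinv := hΘ.invariant g p hp
    -- `TΦ` identifies `ker Θ` with `ker Θ^Φ`; invariance of the latter then follows from that of
    -- the former.
    have hker : ∀ {q r : P} (_ : r = Φ q) (v : EP),
        (PrincipaloidBundle.gaugeTransform Φ Θ r (tder 𝓘(ℝ, EP) 𝓘(ℝ, EP) Φ q v) = (0 : EP)) ↔
          (Θ q v = (0 : EP)) := by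
      intro q r h v
      have h1 := gaugeTransform_tder Φ Θ h v
      refine ⟨fun h0 => ?_, fun h0 => h1.trans ?_⟩
      · have h2 := tder_symm_tder Φ h (Θ q v)
        rw [← h1] at h2
        exact h2.symm.trans ((congrArg (tder 𝓘(ℝ, EP) 𝓘(ℝ, EP) Φ.symm r) h0).trans (map_zero _))
      · exact (congrArg (tder 𝓘(ℝ, EP) 𝓘(ℝ, EP) Φ q) h0).trans (map_zero _)
    ext w
    constructor
    · rintro ⟨v, hv, rfl⟩
      obtain ⟨v, rfl⟩ : ∃ w, tder 𝓘(ℝ, EP) 𝓘(ℝ, EP) Φ p w = v := ⟨_, tder_tder_symm Φ rfl v⟩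
      have hv' : Θ p v = (0 : EP) := (hker rfl v).1 hv
      have h1 : Θ (B.act p g) (B.tAct g p v) = (0 : EP) :=
        hinv.subset (Set.mem_image_of_mem (B.tangentAct g p) hv')
      have h2 := (hker hact _).2 h1
      rw [← hΦ.tAct_tder hp (hΘ.tder_μ_eq_zero hv')] at h2
      exact h2
    · intro hw
      obtain ⟨w, rfl⟩ : ∃ u, tder 𝓘(ℝ, EP) 𝓘(ℝ, EP) Φ (B.act p g) u = w :=
        ⟨_, tder_tder_symm Φ hact w⟩
      obtain ⟨v, hv, hvw⟩ := hinv.superset ((hker hact w).1 hw)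
      refine ⟨tder 𝓘(ℝ, EP) 𝓘(ℝ, EP) Φ p v, (hker rfl v).2 hv, ?_⟩
      exact (hΦ.tAct_tder hp (hΘ.tder_μ_eq_zero hv)).trans
        (congrArg (tder 𝓘(ℝ, EP) 𝓘(ℝ, EP) Φ (B.act p g)) hvw)

end IsConnection

end PrincipaloidBundle

end Bundles

/-! ### Local forms of a connection and existence of local data -/

namespace PrincipaloidBundle.TrivialisingCover

variable {EM EG ES EP : Type*} [NormedAddCommGroup EM] [NormedSpace ℝ EM]
  [NormedAddCommGroup EG] [NormedSpace ℝ EG] [NormedAddCommGroup ES] [NormedSpace ℝ ES]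
  [NormedAddCommGroup EP] [NormedSpace ℝ EP]
  {M 𝒢 : Type*} [TopologicalSpace M] [ChartedSpace EM M]
  [TopologicalSpace 𝒢] [ChartedSpace EG 𝒢]
  {S P : Type*} [TopologicalSpace S] [ChartedSpace ES S]
  [TopologicalSpace P] [ChartedSpace EP P]
  {G : LieGroupoid EM EG M 𝒢} {B : PrincipaloidBundle ES EP S P G}
  {ι : Type*} (T : B.TrivialisingCover ι)
  {Θ : ∀ p : P, TangentSpace 𝓘(ℝ, EP) p →L[ℝ] TangentSpace 𝓘(ℝ, EP) p}

variable (Θ) in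
/-- `T.localForm` between the model vector spaces. -/
def locForm (i : ι) (σ : S) (g : 𝒢) : ES × EG →L[ℝ] ES × EG := T.localForm Θ i σ g

lemma tder_symm_locForm {i : ι} {σ : S} (hσ : σ ∈ T.O i) (g : 𝒢) (w : ES × EG) :
    tder (𝓘(ℝ, ES).prod 𝓘(ℝ, EG)) 𝓘(ℝ, EP) (T.τ i).symm (σ, g) (T.locForm Θ i σ g w) =
      Θ ((T.τ i).symm (σ, g))
        (tder (𝓘(ℝ, ES).prod 𝓘(ℝ, EG)) 𝓘(ℝ, EP) (T.τ i).symm (σ, g) w) :=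
  (T.isLocalTrivialisation i).tder_symm_tder
    ((T.isLocalTrivialisation i).symm_mem_source hσ g)
    ((T.isLocalTrivialisation i).right_inv hσ g).symm _

lemma locForm_eq_zero {i : ι} {σ : S} {g : 𝒢} {w : ES × EG}
    (h : Θ ((T.τ i).symm (σ, g))
      (tder (𝓘(ℝ, ES).prod 𝓘(ℝ, EG)) 𝓘(ℝ, EP) (T.τ i).symm (σ, g) w) = (0 : EP)) :
    T.locForm Θ i σ g w = 0 :=
  (congrArg (tder 𝓘(ℝ, EP) (𝓘(ℝ, ES).prod 𝓘(ℝ, EG)) (T.τ i) ((T.τ i).symm (σ, g))) h).trans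
    (map_zero _)

variable [IsManifold 𝓘(ℝ, EP) ∞ P]

section Connection

variable (hΘ : B.IsConnection Θ) {i : ι} {σ : S} (hσ : σ ∈ T.O i) (g : 𝒢)

include hΘ hσ

lemma locForm_fst (w : ES × EG) : (T.locForm Θ i σ g w).1 = 0 := by
  have hτ := T.isLocalTrivialisation i
  refine (hτ.tder_fst (hτ.symm_mem_source hσ g) _).trans ?_
  exact hΘ.vertical _ _

/-- This is `Tμ ∘ Θ = Tμ` read in the trivialisation. For `w = (v, 0)` at a unit it places the
second component in the algebroid fibre. -/
lemma tder_s_locForm_snd (w : ES × EG) :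
    tder 𝓘(ℝ, EG) 𝓘(ℝ, EM) G.s g (T.locForm Θ i σ g w).2 =
      tder 𝓘(ℝ, EG) 𝓘(ℝ, EM) G.s g w.2 := by
  have hτ := T.isLocalTrivialisation i
  have hg : ((T.τ i) ((T.τ i).symm (σ, g))).2 = g := by rw [hτ.right_inv hσ]
  have h1 := hτ.tder_s_snd (hτ.symm_mem_source hσ g) hg
    (tder (𝓘(ℝ, ES).prod 𝓘(ℝ, EG)) 𝓘(ℝ, EP) (T.τ i).symm (σ, g) w)
  rw [hτ.tder_tder_symm hσ] at h1
  refine (hτ.tder_s_snd (hτ.symm_mem_source hσ g) hg _).trans ?_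
  exact (hΘ.tangent_μ _ _).trans h1.symm

lemma locForm_vertical (V : EG) : T.locForm Θ i σ g (0, V) = (0, V) := by
  have hτ := T.isLocalTrivialisation i
  set p := (T.τ i).symm (σ, g)
  set w : EP := tder (𝓘(ℝ, ES).prod 𝓘(ℝ, EG)) 𝓘(ℝ, EP) (T.τ i).symm (σ, g) (0, V)
  have h1 : tder 𝓘(ℝ, EP) 𝓘(ℝ, ES) B.π p w = 0 := by
    rw [← hτ.tder_fst (hτ.symm_mem_source hσ g), hτ.tder_tder_symm hσ]
  have h2 : Θ p w = w := hΘ.apply_vertical p w h1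
  exact (congrArg (tder 𝓘(ℝ, EP) (𝓘(ℝ, ES).prod 𝓘(ℝ, EG)) (T.τ i) p) h2).trans
    (hτ.tder_tder_symm hσ _)

variable [IsManifold 𝓘(ℝ, EM) ∞ M] [IsManifold 𝓘(ℝ, EG) ∞ 𝒢]

omit hΘ [IsManifold 𝓘(ℝ, EP) ∞ P] in
/-- In a trivialisation, the derivative of the right action is that of right translation. -/
lemma tAct_tder_symm (v : ES) {X : EG}
    (hX : tder 𝓘(ℝ, EG) 𝓘(ℝ, EM) G.s (G.one (G.t g)) X = 0) :
    B.tAct g ((T.τ i).symm (σ, G.one (G.t g)))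
      (tder (𝓘(ℝ, ES).prod 𝓘(ℝ, EG)) 𝓘(ℝ, EP) (T.τ i).symm (σ, G.one (G.t g)) (v, X)) =
      tder (𝓘(ℝ, ES).prod 𝓘(ℝ, EG)) 𝓘(ℝ, EP) (T.τ i).symm (σ, g)
        (v, G.tRight g (G.one (G.t g)) X) := by
  have hτ := T.isLocalTrivialisation i
  obtain ⟨ρ, hρ⟩ := G.exists_retraction (G.one (G.t g))
  set x : S × 𝒢 := (σ, G.one (G.t g))
  have hU : ∀ᶠ z : S × 𝒢 in 𝓝 x, z.1 ∈ T.O i := hτ.eventually_fst_mem hσ _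
  have hs : ∀ᶠ z : S × 𝒢 in 𝓝 x, G.s (ρ z.2) = G.t g := by
    filter_upwards [(continuous_snd.continuousAt (x := x)).eventually hρ.eventually_eq] with z hz
    rw [hz, G.s_one]
  have h1 : MDifferentiableAt (𝓘(ℝ, ES).prod 𝓘(ℝ, EG)) 𝓘(ℝ, ES) (Prod.fst : S × 𝒢 → S) x :=
    mdifferentiableAt_fst
  have h2 : MDifferentiableAt (𝓘(ℝ, ES).prod 𝓘(ℝ, EG)) 𝓘(ℝ, EG) (Prod.snd : S × 𝒢 → 𝒢) x :=
    mdifferentiableAt_snd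
  have h3 : MDifferentiableAt (𝓘(ℝ, ES).prod 𝓘(ℝ, EG)) 𝓘(ℝ, EG) (fun z : S × 𝒢 => ρ z.2) x :=
    hρ.mdifferentiableAt.comp x h2
  have h4 : MDifferentiableAt (𝓘(ℝ, ES).prod 𝓘(ℝ, EG)) 𝓘(ℝ, EG)
      (fun z : S × 𝒢 => G.mul (ρ z.2) g) x :=
    G.mdifferentiableAt_mul h3 mdifferentiableAt_const hs
  have hρx : (fun z : S × 𝒢 => (z.1, ρ z.2)) x = x := by simp only [x, hρ.apply_self]
  have hτx : MDifferentiableAt (𝓘(ℝ, ES).prod 𝓘(ℝ, EG)) 𝓘(ℝ, EP) (T.τ i).symm x :=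
    hτ.mdifferentiableAt_symm hσ _
  have h5 : tder (𝓘(ℝ, ES).prod 𝓘(ℝ, EG)) 𝓘(ℝ, EG) (fun z : S × 𝒢 => ρ z.2) x (v, X) = X := by
    rw [← tder_comp (g := ρ) hρ.mdifferentiableAt h2 rfl, tder_snd, hρ.tder_eq X hX]
  have h6 : tder (𝓘(ℝ, ES).prod 𝓘(ℝ, EG)) (𝓘(ℝ, ES).prod 𝓘(ℝ, EG))
      (fun z : S × 𝒢 => (z.1, ρ z.2)) x (v, X) = (v, X) := by
    rw [tder_prodMk h1 h3, h5, Principaloid.tder_fst]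
  have h7 : tder (𝓘(ℝ, ES).prod 𝓘(ℝ, EG)) (𝓘(ℝ, ES).prod 𝓘(ℝ, EG))
      (fun z : S × 𝒢 => (z.1, G.mul (ρ z.2) g)) x (v, X) =
        (v, G.tRight g (G.one (G.t g)) X) := by
    rw [tder_prodMk h1 h4, Principaloid.tder_fst, ← G.tRight_tder h3 hρ.apply_self hs, h5]
  -- Writing `(v, X)` as its own image under `T(id × ρ)` keeps all nearby points in the domain of
  -- `ϱ_g`.
  conv_lhs => rw [← h6]
  rw [tder_comp hτx (h1.prodMk h3) hρx, B.toRightModule.tAct_tder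
      (c := fun z : S × 𝒢 => (T.τ i).symm (z.1, ρ z.2)) (hτx.comp_of_eq (f := fun z : S × 𝒢 => (z.1, ρ z.2)) x (h1.prodMk h3) hρx)
      (congrArg (T.τ i).symm hρx) ?_, ← h7,
    tder_comp (hτ.mdifferentiableAt_symm hσ g) (h1.prodMk h4)
      (by simp only [x, hρ.apply_self, G.one_mul])]
  · refine tder_congr_apply ?_ _
    filter_upwards [hU, hs] with z hz hz'
    exact hτ.act_symm _ hz _ _ hz'
  · filter_upwards [hU, hs] with z hz hz'
    exact (hτ.μ_symm _ hz _).trans hz'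

/-- With `X` the vertical part of `(v, 0)` at the unit, `(v, -X)` is horizontal there. Invariance of
the kernel makes `(v, -T r_g X)` horizontal at `g`, and `(v, V)` differs from it by a vertical
vector, which the form fixes. -/
lemma locForm_apply (v : ES) (V : EG) :
    T.locForm Θ i σ g (v, V) = (0, V + G.tRight g (G.one (G.t g))
      (T.locForm Θ i σ (G.one (G.t g)) (v, 0)).2) := by
  have hτ := T.isLocalTrivialisation i
  set X : EG := (T.locForm Θ i σ (G.one (G.t g)) (v, 0)).2 with hX
  have hX0 : tder 𝓘(ℝ, EG) 𝓘(ℝ, EM) G.s (G.one (G.t g)) (-X) = 0 := by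
    rw [map_neg, T.tder_s_locForm_snd hΘ hσ, map_zero, neg_zero]
  have h1 : T.locForm Θ i σ (G.one (G.t g)) (v, -X) = 0 := by
    have : ((v, -X) : ES × EG) = (v, 0) + (0, -X) := by simp
    rw [this, map_add, T.locForm_vertical hΘ hσ]
    refine Prod.ext ?_ ?_
    · simp [T.locForm_fst hΘ hσ]
    · simp [← hX]
  have h2 := T.tder_symm_locForm (Θ := Θ) hσ (G.one (G.t g)) (v, -X)
  rw [h1, map_zero] at h2
  have hμ : B.μ ((T.τ i).symm (σ, G.one (G.t g))) = G.t g := by rw [hτ.μ_symm _ hσ, G.s_one]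
  have hact : B.act ((T.τ i).symm (σ, G.one (G.t g))) g = (T.τ i).symm (σ, g) := by
    rw [hτ.act_symm _ hσ _ _ (G.s_one _), G.one_mul]
  have h3 : Θ (B.act ((T.τ i).symm (σ, G.one (G.t g))) g)
      (B.tAct g ((T.τ i).symm (σ, G.one (G.t g))) _) = (0 : EP) :=
    (hΘ.invariant g _ hμ).subset
      (Set.mem_image_of_mem (B.tangentAct g ((T.τ i).symm (σ, G.one (G.t g)))) h2.symm)
  rw [T.tAct_tder_symm hσ g v hX0, hact] at h3
  have h4 := T.locForm_eq_zero h3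
  have h5 : ((v, V) : ES × EG) = (v, G.tRight g (G.one (G.t g)) (-X)) +
      (0, V + G.tRight g (G.one (G.t g)) X) := by simp
  rw [h5, map_add, h4, T.locForm_vertical hΘ hσ, zero_add]

end Connection

section LocalData

variable [IsManifold 𝓘(ℝ, EM) ∞ M] [IsManifold 𝓘(ℝ, EG) ∞ 𝒢] [IsManifold 𝓘(ℝ, ES) ∞ S]

omit [IsManifold 𝓘(ℝ, EM) ∞ M] in
-- The map is a composite of smooth ones: lift by the zero vector at `Id_m`, then `Tτ⁻¹`, `Θ`, `Tτ`
-- and `T pr₂`.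
lemma contMDiffOn_locForm_one (hΘ : B.IsConnection Θ) (i : ι) :
    ContMDiffOn (𝓘(ℝ, ES).tangent.prod 𝓘(ℝ, EM)) 𝓘(ℝ, EG).tangent ∞
      (fun x : TangentBundle 𝓘(ℝ, ES) S × M =>
        (⟨G.one x.2, (T.locForm Θ i x.1.1 (G.one x.2) (x.1.2, 0)).2⟩ :
          TangentBundle 𝓘(ℝ, EG) 𝒢))
      {x | x.1.1 ∈ T.O i} := by
  have hτ := T.isLocalTrivialisation i
  have : IsManifold 𝓘(ℝ, ES) 1 S := .of_le (n := ∞) (by simp)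
  have : IsManifold 𝓘(ℝ, EG) 1 𝒢 := .of_le (n := ∞) (by simp)
  have : IsManifold 𝓘(ℝ, EP) 1 P := .of_le (n := ∞) (by simp)
  have h0 : ContMDiff (𝓘(ℝ, ES).tangent.prod 𝓘(ℝ, EM)) 𝓘(ℝ, EG).tangent ∞
      (fun x : TangentBundle 𝓘(ℝ, ES) S × M =>
        (⟨G.one x.2, (0 : EG)⟩ : TangentBundle 𝓘(ℝ, EG) 𝒢)) :=
    (Bundle.contMDiff_zeroSection ℝ (TangentSpace 𝓘(ℝ, EG) : 𝒢 → Type _)).comp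
      (G.contMDiff_one.comp contMDiff_snd)
  have h1 : ContMDiff (𝓘(ℝ, ES).tangent.prod 𝓘(ℝ, EM)) (𝓘(ℝ, ES).prod 𝓘(ℝ, EG)).tangent ∞
      (fun x : TangentBundle 𝓘(ℝ, ES) S × M =>
        (equivTangentBundleProd 𝓘(ℝ, ES) S 𝓘(ℝ, EG) 𝒢).symm (x.1, ⟨G.one x.2, (0 : EG)⟩)) :=
    contMDiff_equivTangentBundleProd_symm.comp (contMDiff_fst.prodMk h0)
  have h2 := hτ.contMDiffOn_symm.contMDiffOn_tangentMapWithin (m := ∞) (by simp)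
    (T.τ i).open_target.uniqueMDiffOn
  have h3 := hτ.contMDiffOn.contMDiffOn_tangentMapWithin (m := ∞) (by simp)
    (T.τ i).open_source.uniqueMDiffOn
  have h4 : ContMDiff (𝓘(ℝ, ES).prod 𝓘(ℝ, EG)).tangent 𝓘(ℝ, EG).tangent ∞
      (tangentMap (𝓘(ℝ, ES).prod 𝓘(ℝ, EG)) 𝓘(ℝ, EG) (Prod.snd : S × 𝒢 → 𝒢)) :=
    (contMDiff_snd (n := ∞)).contMDiff_tangentMap (by simp)
  have h5 := h4.comp_contMDiffOn (h3.comp (hΘ.contMDiff.comp_contMDiffOn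
    (h2.comp h1.contMDiffOn (s := {x : TangentBundle 𝓘(ℝ, ES) S × M | x.1.1 ∈ T.O i}) fun x hx =>
      hτ.mem_target (σ := x.1.1) hx (G.one x.2)))
    fun x hx =>
      hτ.symm_mem_source (σ := x.1.1) hx (G.one x.2))
  refine h5.congr fun x hx => ?_
  set g := G.one x.2
  set p := (T.τ i).symm (x.1.1, g)
  have e1 : tderWithin (𝓘(ℝ, ES).prod 𝓘(ℝ, EG)) 𝓘(ℝ, EP) (T.τ i).symm (T.τ i).target (x.1.1, g) =
      tder (𝓘(ℝ, ES).prod 𝓘(ℝ, EG)) 𝓘(ℝ, EP) (T.τ i).symm (x.1.1, g) :=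
    mfderivWithin_of_isOpen (T.τ i).open_target (hτ.mem_target hx g)
  have e2 : tderWithin 𝓘(ℝ, EP) (𝓘(ℝ, ES).prod 𝓘(ℝ, EG)) (T.τ i) (T.τ i).source p =
      tder 𝓘(ℝ, EP) (𝓘(ℝ, ES).prod 𝓘(ℝ, EG)) (T.τ i) p :=
    mfderivWithin_of_isOpen (T.τ i).open_source (hτ.symm_mem_source hx g)
  have e : (T.locForm Θ i x.1.1 g (x.1.2, 0)).2 =
      tder (𝓘(ℝ, ES).prod 𝓘(ℝ, EG)) 𝓘(ℝ, EG) (Prod.snd : S × 𝒢 → 𝒢) (T.τ i p)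
        (tderWithin 𝓘(ℝ, EP) (𝓘(ℝ, ES).prod 𝓘(ℝ, EG)) (T.τ i) (T.τ i).source p
          (Θ p (tderWithin (𝓘(ℝ, ES).prod 𝓘(ℝ, EG)) 𝓘(ℝ, EP) (T.τ i).symm (T.τ i).target
            (x.1.1, g) (x.1.2, 0)))) := by
    rw [e1, e2, tder_snd]
    rfl
  rw [e]
  exact tangentBundle_mk_congr (congrArg Prod.snd (hτ.right_inv hx g)).symm _

lemma exists_isLocalConnectionData (hΘ : B.IsConnection Θ) :
    ∃ A : ι → ∀ (σ : S) (m : M), TangentSpace 𝓘(ℝ, ES) σ →L[ℝ] G.algebroidFibre m,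
      T.IsLocalConnectionData Θ A := by
  classical
  let D (i : ι) (σ : S) (m : M) : ES →L[ℝ] EG :=
    (ContinuousLinearMap.snd ℝ ES EG) ∘L (T.locForm Θ i σ (G.one m)) ∘L
      (ContinuousLinearMap.inl ℝ ES EG)
  have hD : ∀ i σ m (_ : σ ∈ T.O i) (v : ES), D i σ m v ∈ G.algebroidFibre m := by
    intro i σ m hσ v
    have := T.tder_s_locForm_snd hΘ hσ (G.one m) (v, 0)
    exact this.trans (map_zero _)
  -- The value `0` off `T.O i` is arbitrary: local data are constrained only over the cover member.
  let A (i : ι) (σ : S) (m : M) : TangentSpace 𝓘(ℝ, ES) σ →L[ℝ] G.algebroidFibre m :=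
    if h : σ ∈ T.O i then
      ContinuousLinearMap.codRestrict (D i σ m) (G.algebroidFibre m) (hD i σ m h) else 0
  have hA : ∀ i σ m (_ : σ ∈ T.O i) (v : ES),
      ((A i σ m v : TangentSpace 𝓘(ℝ, EG) (G.one m)) : EG) =
        (T.locForm Θ i σ (G.one m) (v, 0)).2 := by
    intro i σ m hσ v
    have h : A i σ m =
        ContinuousLinearMap.codRestrict (D i σ m) (G.algebroidFibre m) (hD i σ m hσ) := dif_pos hσ
    rw [h]
    rfl
  refine ⟨A, fun i => ?_, fun i σ hσ g v V => ?_⟩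
  · refine (T.contMDiffOn_locForm_one hΘ i).congr fun x hx => ?_
    exact congrArg (fun u : EG => (⟨G.one x.2, u⟩ : TangentBundle 𝓘(ℝ, EG) 𝒢)) (hA i _ _ hx _)
  · refine (T.locForm_apply hΘ hσ g v V).trans ?_
    rw [← hA i σ _ hσ v]
    rfl

end LocalData

end PrincipaloidBundle.TrivialisingCover

/-! ### Automorphisms in trivialisations and the transformation law -/

namespace PrincipaloidBundle.TrivialisingCover

variable {EM EG ES EP : Type*} [NormedAddCommGroup EM] [NormedSpace ℝ EM]
  [NormedAddCommGroup EG] [NormedSpace ℝ EG] [NormedAddCommGroup ES] [NormedSpace ℝ ES]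
  [NormedAddCommGroup EP] [NormedSpace ℝ EP]
  {M 𝒢 : Type*} [TopologicalSpace M] [ChartedSpace EM M]
  [TopologicalSpace 𝒢] [ChartedSpace EG 𝒢]
  {S P : Type*} [TopologicalSpace S] [ChartedSpace ES S]
  [TopologicalSpace P] [ChartedSpace EP P]
  {G : LieGroupoid EM EG M 𝒢} {B : PrincipaloidBundle ES EP S P G}
  {ι : Type*} {T : B.TrivialisingCover ι}
  {Θ : ∀ p : P, TangentSpace 𝓘(ℝ, EP) p →L[ℝ] TangentSpace 𝓘(ℝ, EP) p}
  {Φ : Diffeomorph 𝓘(ℝ, EP) 𝓘(ℝ, EP) P P ∞} {f : Diffeomorph 𝓘(ℝ, ES) 𝓘(ℝ, ES) S S ∞}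
  {γ : ι → ι → S → G.Bisection}

namespace IsLocalPresentation

variable (hγ : T.IsLocalPresentation Φ f γ) {j i : ι} {σ : S} (hi : σ ∈ T.O i) (hj : f σ ∈ T.O j)

include hγ hi hj

omit hγ in
lemma eventually_mem (m : M) :
    ∀ᶠ z : S × M in 𝓝 (σ, m), z.1 ∈ T.O i ∧ f z.1 ∈ T.O j := by
  have h1 : ∀ᶠ s in 𝓝 σ, s ∈ T.O i := (T.isLocalTrivialisation i).isOpen.mem_nhds hi
  have h2 : ∀ᶠ s in 𝓝 σ, f s ∈ T.O j :=
    f.continuous.continuousAt ((T.isLocalTrivialisation j).isOpen.mem_nhds hj)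
  exact (continuous_fst.continuousAt (x := (σ, m))).eventually (h1.and h2)

lemma mdifferentiableAt_left (g : 𝒢) :
    MDifferentiableAt (𝓘(ℝ, ES).prod 𝓘(ℝ, EG)) 𝓘(ℝ, EG)
      (fun z : S × 𝒢 => (γ j i z.1).left z.2) (σ, g) := by
  have h1 : MDifferentiableAt (𝓘(ℝ, ES).prod 𝓘(ℝ, EM)) 𝓘(ℝ, EG)
      (fun x : S × M => (γ j i x.1).toFun x.2) (σ, G.t g) :=
    ((hγ.contMDiffOn j i).contMDiffAt (eventually_mem hi hj _)).mdifferentiableAt (by simp)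
  have h2 : MDifferentiableAt (𝓘(ℝ, ES).prod 𝓘(ℝ, EG)) (𝓘(ℝ, ES).prod 𝓘(ℝ, EM))
      (fun z : S × 𝒢 => (z.1, G.t z.2)) (σ, g) :=
    mdifferentiableAt_fst.prodMk
      ((G.contMDiff_t.mdifferentiable (by simp) g).comp (σ, g) mdifferentiableAt_snd)
  exact G.mdifferentiableAt_mul (h1.comp (σ, g) h2) mdifferentiableAt_snd
    (.of_forall fun z => (γ j i z.1).s_toFun _)

/-- The presentation of an automorphism in local trivialisations intertwines the local forms. -/
lemma locForm_gaugeTransform (g : 𝒢) (u : ES × EG) :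
    T.locForm (gaugeTransform Φ Θ) j (f σ) ((γ j i σ).left g)
      (tder (𝓘(ℝ, ES).prod 𝓘(ℝ, EG)) (𝓘(ℝ, ES).prod 𝓘(ℝ, EG))
        (fun z : S × 𝒢 => (f z.1, (γ j i z.1).left z.2)) (σ, g) u) =
      tder (𝓘(ℝ, ES).prod 𝓘(ℝ, EG)) (𝓘(ℝ, ES).prod 𝓘(ℝ, EG))
        (fun z : S × 𝒢 => (f z.1, (γ j i z.1).left z.2)) (σ, g) (T.locForm Θ i σ g u) := by
  have hτi := T.isLocalTrivialisation i
  have hτj := T.isLocalTrivialisation j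
  have hF : MDifferentiableAt (𝓘(ℝ, ES).prod 𝓘(ℝ, EG)) (𝓘(ℝ, ES).prod 𝓘(ℝ, EG))
      (fun z : S × 𝒢 => (f z.1, (γ j i z.1).left z.2)) (σ, g) :=
    ((mdifferentiableAt_diffeomorph f σ).comp (σ, g) mdifferentiableAt_fst).prodMk
      (mdifferentiableAt_left hγ hi hj g)
  have h1 : ∀ w, tder (𝓘(ℝ, ES).prod 𝓘(ℝ, EG)) 𝓘(ℝ, EP) (T.τ j).symm (f σ, (γ j i σ).left g)
      (tder (𝓘(ℝ, ES).prod 𝓘(ℝ, EG)) (𝓘(ℝ, ES).prod 𝓘(ℝ, EG))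
        (fun z : S × 𝒢 => (f z.1, (γ j i z.1).left z.2)) (σ, g) w) =
      tder 𝓘(ℝ, EP) 𝓘(ℝ, EP) Φ ((T.τ i).symm (σ, g))
        (tder (𝓘(ℝ, ES).prod 𝓘(ℝ, EG)) 𝓘(ℝ, EP) (T.τ i).symm (σ, g) w) := by
    intro w
    rw [tder_comp (hτj.mdifferentiableAt_symm hj _) hF rfl,
      tder_comp (mdifferentiableAt_diffeomorph Φ _) (hτi.mdifferentiableAt_symm hi g) rfl]
    refine tder_congr_apply ?_ w
    have h1 : ∀ᶠ s in 𝓝 σ, s ∈ T.O i := hτi.isOpen.mem_nhds hi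
    have h2 : ∀ᶠ s in 𝓝 σ, f s ∈ T.O j := f.continuous.continuousAt (hτj.isOpen.mem_nhds hj)
    filter_upwards [(continuous_fst.continuousAt (x := (σ, g))).eventually (h1.and h2)] with z hz
    exact (hγ.apply_symm j i _ hz.1 hz.2 _).symm
  have h2 := gaugeTransform_tder Φ Θ (hγ.apply_symm j i σ hi hj g).symm
    (tder (𝓘(ℝ, ES).prod 𝓘(ℝ, EG)) 𝓘(ℝ, EP) (T.τ i).symm (σ, g) u)
  rw [← T.tder_symm_locForm hi, ← h1, ← h1] at h2
  have h3 := congrArg (tder 𝓘(ℝ, EP) (𝓘(ℝ, ES).prod 𝓘(ℝ, EG)) (T.τ j)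
    ((T.τ j).symm (f σ, (γ j i σ).left g))) h2
  rw [hτj.tder_tder_symm hj] at h3
  exact h3

lemma tder_presentation_base (m : M) (v : ES) :
    tder (𝓘(ℝ, ES).prod 𝓘(ℝ, EG)) (𝓘(ℝ, ES).prod 𝓘(ℝ, EG))
        (fun z : S × 𝒢 => (f z.1, (γ j i z.1).left z.2)) (σ, G.one m) (v, 0) =
      (tder 𝓘(ℝ, ES) 𝓘(ℝ, ES) f σ v,
        tder 𝓘(ℝ, ES) 𝓘(ℝ, EG) (fun s => (γ j i s).toFun m) σ v) := by
  have hL := mdifferentiableAt_left hγ hi hj (G.one m)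
  have hc : MDifferentiableAt 𝓘(ℝ, ES) (𝓘(ℝ, ES).prod 𝓘(ℝ, EG))
      (fun s : S => (s, G.one m)) σ := mdifferentiableAt_id.prodMk mdifferentiableAt_const
  have hf : MDifferentiableAt (𝓘(ℝ, ES).prod 𝓘(ℝ, EG)) 𝓘(ℝ, ES) (fun z : S × 𝒢 => f z.1)
      (σ, G.one m) := (mdifferentiableAt_diffeomorph f σ).comp (σ, G.one m) mdifferentiableAt_fst
  rw [tder_prodMk hf hL, ← tder_prodMk_left (I := 𝓘(ℝ, ES)) (J := 𝓘(ℝ, EG)) σ (G.one m) v, tder_comp hL hc rfl,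
    tder_comp hf hc rfl]
  simp only [LieGroupoid.Bisection.left_one]

lemma tder_presentation_fibre (g : 𝒢) (X : EG) :
    tder (𝓘(ℝ, ES).prod 𝓘(ℝ, EG)) (𝓘(ℝ, ES).prod 𝓘(ℝ, EG))
        (fun z : S × 𝒢 => (f z.1, (γ j i z.1).left z.2)) (σ, g) (0, X) =
      (0, tder 𝓘(ℝ, EG) 𝓘(ℝ, EG) (γ j i σ).left g X) := by
  have hL := mdifferentiableAt_left hγ hi hj g
  have hf : MDifferentiableAt (𝓘(ℝ, ES).prod 𝓘(ℝ, EG)) 𝓘(ℝ, ES) (fun z : S × 𝒢 => f z.1) (σ, g) :=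
    (mdifferentiableAt_diffeomorph f σ).comp (σ, g) mdifferentiableAt_fst
  have hc : MDifferentiableAt 𝓘(ℝ, EG) (𝓘(ℝ, ES).prod 𝓘(ℝ, EG))
      (fun k : 𝒢 => (σ, k)) g := mdifferentiableAt_const.prodMk mdifferentiableAt_id
  rw [tder_prodMk hf hL, ← tder_prodMk_right (I := 𝓘(ℝ, ES)) (J := 𝓘(ℝ, EG)) σ g X, tder_comp hL hc rfl, tder_comp hf hc rfl]
  exact Prod.ext (tder_const (J := 𝓘(ℝ, ES)) g (f σ) X) rfl

variable [IsManifold 𝓘(ℝ, EM) ∞ M] [IsManifold 𝓘(ℝ, EG) ∞ 𝒢] [IsManifold 𝓘(ℝ, ES) ∞ S]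

/-- The gauge transformation law of the local connection data. -/
lemma localConnectionData_gaugeTransform
    {A A' : ι → ∀ (σ : S) (m : M), TangentSpace 𝓘(ℝ, ES) σ →L[ℝ] G.algebroidFibre m}
    (hA : T.IsLocalConnectionData Θ A)
    (hA' : T.IsLocalConnectionData (gaugeTransform Φ Θ) A')
    (m : M) (v : TangentSpace 𝓘(ℝ, ES) σ) :
    (A' j (f σ) ((γ j i σ).shadow m) (mfderiv 𝓘(ℝ, ES) 𝓘(ℝ, ES) f σ v) :
        TangentSpace 𝓘(ℝ, EG) (G.one ((γ j i σ).shadow m))) =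
      (γ j i σ).tangentConj m (A i σ m v) -
        LieGroupoid.Bisection.pullbackMaurerCartan (γ j i) m σ v := by
  set β := γ j i σ
  set b := β.toFun m
  let X : M → EG := fun k => (A i σ k v : TangentSpace 𝓘(ℝ, EG) (G.one k))
  let Y : EG := (A' j (f σ) (G.t b) (mfderiv 𝓘(ℝ, ES) 𝓘(ℝ, ES) f σ v) :
    TangentSpace 𝓘(ℝ, EG) (G.one (G.t b)))
  set w : EG := tder 𝓘(ℝ, ES) 𝓘(ℝ, EG) (fun s => (γ j i s).toFun m) σ v
  have hX : tder 𝓘(ℝ, EG) 𝓘(ℝ, EM) G.s (G.one m) (X m) = 0 := (A i σ m v).2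
  have hY : tder 𝓘(ℝ, EG) 𝓘(ℝ, EM) G.s (G.one (G.t b)) Y = 0 := (A' j (f σ) (G.t b) _).2
  have h1 : T.locForm Θ i σ (G.one m) (v, 0) = (0, X m) := by
    have h2 : ∀ k, k = m → G.tRight (G.one m) (G.one k) (X k) = X m := by
      rintro k rfl
      exact G.tRight_one hX
    refine (hA.formula i σ hi (G.one m) v 0).trans (Prod.ext rfl ?_)
    exact (zero_add _).trans (h2 _ (G.t_one m))
  have h3 : T.locForm (gaugeTransform Φ Θ) j (f σ) b (tder 𝓘(ℝ, ES) 𝓘(ℝ, ES) f σ v, w) =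
      (0, w + G.tRight b (G.one (G.t b)) Y) :=
    hA'.formula j (f σ) hj b _ w
  have h4 := locForm_gaugeTransform (Θ := Θ) hγ hi hj (G.one m) (v, 0)
  rw [h1, tder_presentation_fibre hγ hi hj, LieGroupoid.Bisection.left_one] at h4
  have h7 := congrArg (T.locForm (gaugeTransform Φ Θ) j (f σ) b)
    (tder_presentation_base hγ hi hj m v)
  have h5 : w + G.tRight b (G.one (G.t b)) Y = tder 𝓘(ℝ, EG) 𝓘(ℝ, EG) β.left (G.one m) (X m) :=
    congrArg Prod.snd ((h7.trans h3).symm.trans h4)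
  have h6 := congrArg (G.tRight (G.inv b) b) h5
  rw [map_add, G.tRight_inv_tRight hY, β.tRight_inv_tder_left hX] at h6
  exact eq_sub_of_add_eq' h6

end IsLocalPresentation

end PrincipaloidBundle.TrivialisingCover

end Principaloid

end

theorem mainTheorem11
    {EM EG ES EP : Type*}
    [NormedAddCommGroup EM] [NormedSpace ℝ EM] [FiniteDimensional ℝ EM]
    [NormedAddCommGroup EG] [NormedSpace ℝ EG] [FiniteDimensional ℝ EG]
    [NormedAddCommGroup ES] [NormedSpace ℝ ES] [FiniteDimensional ℝ ES]
    [NormedAddCommGroup EP] [NormedSpace ℝ EP] [FiniteDimensional ℝ EP]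
    {M 𝒢 S P : Type*}
    [TopologicalSpace M] [ChartedSpace EM M] [IsManifold 𝓘(ℝ, EM) ∞ M]
    [TopologicalSpace 𝒢] [ChartedSpace EG 𝒢] [IsManifold 𝓘(ℝ, EG) ∞ 𝒢]
    [TopologicalSpace S] [ChartedSpace ES S] [IsManifold 𝓘(ℝ, ES) ∞ S]
    [TopologicalSpace P] [ChartedSpace EP P] [IsManifold 𝓘(ℝ, EP) ∞ P]
    (G : Principaloid.LieGroupoid EM EG M 𝒢)
    (B : Principaloid.PrincipaloidBundle ES EP S P G)
    {ι : Type*} (T : B.TrivialisingCover ι)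
    (Θ : ∀ p : P, TangentSpace 𝓘(ℝ, EP) p →L[ℝ] TangentSpace 𝓘(ℝ, EP) p)
    (hΘ : B.IsConnection Θ)
    (A : ι → ∀ (σ : S) (m : M), TangentSpace 𝓘(ℝ, ES) σ →L[ℝ] G.algebroidFibre m)
    (hA : T.IsLocalConnectionData Θ A)
    (Φ : Diffeomorph 𝓘(ℝ, EP) 𝓘(ℝ, EP) P P ∞)
    (f : Diffeomorph 𝓘(ℝ, ES) 𝓘(ℝ, ES) S S ∞)
    (hΦ : B.IsAutomorphism Φ f)
    (γ : ι → ι → S → G.Bisection)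
    (hγ : T.IsLocalPresentation Φ f γ) :
    B.IsConnection (Principaloid.PrincipaloidBundle.gaugeTransform Φ Θ) ∧
    (∃ A' : ι → ∀ (σ : S) (m : M), TangentSpace 𝓘(ℝ, ES) σ →L[ℝ] G.algebroidFibre m,
      T.IsLocalConnectionData (Principaloid.PrincipaloidBundle.gaugeTransform Φ Θ) A') ∧
    ∀ A' : ι → ∀ (σ : S) (m : M), TangentSpace 𝓘(ℝ, ES) σ →L[ℝ] G.algebroidFibre m,
      T.IsLocalConnectionData (Principaloid.PrincipaloidBundle.gaugeTransform Φ Θ) A' →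
      (∀ (j i : ι) (σ : S), σ ∈ T.O i → f σ ∈ T.O j →
        ∀ (m : M) (v : TangentSpace 𝓘(ℝ, ES) σ),
        (A' j (f σ) ((γ j i σ).shadow m) (mfderiv 𝓘(ℝ, ES) 𝓘(ℝ, ES) f σ v) :
            TangentSpace 𝓘(ℝ, EG) (G.one ((γ j i σ).shadow m))) =
          (γ j i σ).tangentConj m (A i σ m v) -
            Principaloid.LieGroupoid.Bisection.pullbackMaurerCartan (γ j i) m σ v) ∧
      ((∀ σ, f σ = σ) → ∀ (i : ι) (σ : S), σ ∈ T.O i →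
        ∀ (m : M) (v : TangentSpace 𝓘(ℝ, ES) σ),
        (A' i σ ((γ i i σ).shadow m) v :
            TangentSpace 𝓘(ℝ, EG) (G.one ((γ i i σ).shadow m))) =
          (γ i i σ).tangentConj m (A i σ m v) -
            Principaloid.LieGroupoid.Bisection.pullbackMaurerCartan (γ i i) m σ v) := by
  have hΘΦ := hΘ.gaugeTransform hΦ
  refine ⟨hΘΦ, T.exists_isLocalConnectionData hΘΦ, fun A' hA' => ?_⟩
  have hlaw : ∀ (j i : ι) (σ : S) (hi : σ ∈ T.O i) (hj : f σ ∈ T.O j) (m : M)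
      (v : TangentSpace 𝓘(ℝ, ES) σ), _ := fun j i σ hi hj m v =>
    hγ.localConnectionData_gaugeTransform (j := j) hi hj hA hA' m v
  refine ⟨hlaw, fun hf i σ hσ m v => ?_⟩
  have hfid : (f : S → S) = fun s => s := funext hf
  have h1 : ∀ u : ES, Principaloid.tder 𝓘(ℝ, ES) 𝓘(ℝ, ES) f σ u = u := fun u => by
    rw [hfid, Principaloid.tder_id]
  let a : S → ES → EG := fun s u =>
    (A' i s ((γ i i σ).shadow m) u : TangentSpace 𝓘(ℝ, EG) (G.one ((γ i i σ).shadow m)))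
  have h2 : a (f σ) (Principaloid.tder 𝓘(ℝ, ES) 𝓘(ℝ, ES) f σ v) = a σ v :=
    (congrArg (a (f σ)) (h1 v)).trans (congrArg (fun s => a s v) (hf σ))
  exact h2.symm.trans (hlaw i i σ hσ ((hf σ).symm ▸ hσ) m v)
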